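/- Let $\Omega\subset\mathbb R^3$ be a bounded Lipschitz domain with a geometrically conforming mesh $\mathcal T$ of tetrahedra, let $k\ge 0$, $\Delta t>0$, $f\in L^2(\Omega)^3$, $p_0\in L^2(\Omega)$, and choose for every $T\in\mathcal T$ a face $F^\star_T$ of $T$. Let $W$, $V$, $Q$ be the spaces of functions that on every $T\in\mathcal T$ belong to $[\mathcal P_k(T)]^{3\times3}$, $[\mathcal P_k(T)]^3$, $\mathcal P_k(T)$, respectively (without continuity between cells), and let $M$ be the space of functions on the mesh skeleton that belong to $[\mathcal P_k(F)]^3$ on every face $F$ and vanish on the faces in $\partial\Omega$. Write $(\cdot,\cdot)$ for the $L^2(\Omega)$ inner product, with derivatives taken cell by cell, $\langle\!\langle a,b\rangle\!\rangle=\sum_{T\in\mathcal T}\int_{\partial T}a\cdot b\,d\sigma$, and $\nu$ for the outward unit normal of $T$ on $\partial T$. For a number $\tau^\star>0$ let $S=\tau\,\mathrm{Id}$, where on $\partial T$ one sets $\tau=\tau^\star$ on $F^\star_T$ and $\tau=0$ on $\partial T\setminus F_T^\star$. The iterates of the augmented Lagrangian single face hybridizable (SFH) method are defined as follows: $p^0\in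 Q$ is the $L^2$ projection of $p_0$, and for $n\ge1$, $(L^n,u^n,p^n,\lambda^n)\in W\times V\times Q\times M$ satisfies $$(L^n,G)+(u^n,\nabla\cdot G)-\langle\!\langle\lambda^n,G\nu\rangle\!\rangle=0,$$ $$(-\nabla\cdot L^n+\nabla p^n,v)+\langle\!\langle S(u^n-\lambda^n),v\rangle\!\rangle=(f,v),$$ $$\tfrac1{\Delta t}(p^n,q)-(u^n,\nabla q)+\langle\!\langle\lambda^n\cdot\nu,q\rangle\!\rangle=\tfrac1{\Delta t}(p^{n-1},q),$$ $$\langle\!\langle -L^n\nu+p^n\nu+S(u^n-\lambda^n),\mu\rangle\!\rangle=0$$ for all $(G,v,q,\mu)\in W\times V\times Q\times M$. Then for every $\tau^\star>0$ the iterates exist and are unique for all $n\ge1$, and $\lambda^n$, $p^n$ and $L^n$ do not depend on the choice of $\tau^\star$. The velocity $u^n$ in general does depend on $\tau^\star$: for any $\tau_1^\star\ne\tau_2^\star$ and any $n\ge1$, the corresponding velocities $u^n$ coincide if and only if on every cell $T$ the function $f$ is $L^2(T)$-orthogonal to all $v\in[\mathcal P_k(T)]^3$ that are $L^2(T)$-orthogonal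 to $[\mathcal P_{k-1}(T)]^3$ (with $\mathcal P_{-1}=\{0\}$), and there are $f\in L^2(\Omega)^3$ for which this condition fails. -/

import Mathlib

open MeasureTheory

noncomputable section

namespace StokesHDG

/-- Points (and vectors) of Euclidean three-space. -/
abbrev Pt : Type := EuclideanSpace ℝ (Fin 3)

/-- Real polynomial functions in the three space variables. -/
abbrev Poly : Type := MvPolynomial (Fin 3) ℝ

/-- The value of a polynomial at a point. -/
def ev (q : Poly) (x : Pt) : ℝ := MvPolynomial.eval (fun i => x i) q

/-- The polynomials of total degree at most `k`. -/
abbrev P (k : ℕ) : Submodule ℝ Poly := MvPolynomial.restrictTotalDegree (Fin 3) ℝ k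

/-- The partial derivative with respect to the `j`-th variable. -/
abbrev dd (j : Fin 3) (q : Poly) : Poly := MvPolynomial.pderiv j q

/-- A geometrically conforming tetrahedral mesh of `Ω`: a finite geometric simplicial complex,
each simplex of which is a face of a tetrahedron, and which fills the closure of `Ω`. -/
structure Mesh (Ω : Set Pt) extends Geometry.SimplicialComplex ℝ Pt where
  finite_faces : toSimplicialComplex.faces.Finite
  pure : ∀ s ∈ toSimplicialComplex.faces,
    ∃ T ∈ toSimplicialComplex.faces, s ⊆ T ∧ T.card = 4
  space_eq : toSimplicialComplex.space = closure Ω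

/-- The solid simplex with the given vertices. -/
abbrev hull (s : Finset Pt) : Set Pt := convexHull ℝ (s : Set Pt)

/-- The unit normal to the triangle `F`, outward with respect to a tetrahedron `T` that has `F` as
a face: the normalized component, orthogonal to `F`, of the vector from the centroid of `T` to the
centroid of `F`. -/
def normal (T F : Finset Pt) : Pt :=
  NormedSpace.normalize ((vectorSpan ℝ (F : Set Pt))ᗮ.starProjection
    (F.centroid ℝ id - T.centroid ℝ id))

/-- The `L²` inner product on a tetrahedron of two (scalar, vector or matrix valued) functions,
given by their families of components. -/
def cellInner {ι : Type} [Fintype ι] (T : Finset Pt) (a b : ι → Pt → ℝ) : ℝ :=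
  ∫ x in hull T, ∑ i, a i x * b i x

namespace Mesh

variable {Ω : Set Pt} (M : Mesh Ω)

/-- The tetrahedra of the mesh. -/
def cells : Finset (Finset Pt) := M.finite_faces.toFinset.filter (fun s => s.card = 4)

/-- The triangular faces of the mesh. -/
def facets : Finset (Finset Pt) := M.finite_faces.toFinset.filter (fun s => s.card = 3)

open Classical in
/-- The triangular faces of the cell `T`, whose union is the boundary of `T`. -/
def facetsOf (T : M.cells) : Finset M.facets :=
  Finset.univ.filter (fun F => (F : Finset Pt) ⊆ (T : Finset Pt))

/-- Boundary (Dirichlet) faces: those which belong to exactly one cell. -/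
def IsBoundary (F : M.facets) : Prop := ∃! T : M.cells, F ∈ M.facetsOf T

/-- Piecewise polynomial matrix fields, given cell by cell (with no continuity
between cells); a polynomial is determined by its restriction to a cell. -/
abbrev MatField : Type := M.cells → Fin 3 → Fin 3 → Poly

/-- Piecewise polynomial vector fields. -/
abbrev VecField : Type := M.cells → Fin 3 → Poly

/-- Piecewise polynomial scalar fields. -/
abbrev ScalField : Type := M.cells → Poly

/-- Vector valued functions on the skeleton, given face by face; only the values of the `F`-th
function on the triangle `F` are meaningful. -/
abbrev SkelField : Type := M.facets → Pt → Fin 3 → ℝ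

/-- The approximation space of the velocity gradient: piecewise `[P_k(T)]^{3×3}`. -/
def W (k : ℕ) : Set M.MatField := {G | ∀ T i j, G T i j ∈ P k}

/-- The approximation space of the velocity: piecewise `[P_k(T)]^3`. -/
def V (k : ℕ) : Set M.VecField := {v | ∀ T i, v T i ∈ P k}

/-- The approximation space of the pressure: piecewise `P_k(T)`. -/
def Q (k : ℕ) : Set M.ScalField := {q | ∀ T, q T ∈ P k}

/-- The skeleton space: on each face the restriction of a vector polynomial of degree at most `k`,
and zero on the boundary faces. -/
def Tr (k : ℕ) : Set M.SkelField :=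
  {lam | ∀ F : M.facets,
    (∃ g : Fin 3 → Poly, (∀ i, g i ∈ P k) ∧ ∀ x ∈ hull F, ∀ i, lam F x i = ev (g i) x) ∧
    (M.IsBoundary F → ∀ x ∈ hull F, lam F x = 0)}

/-- `(L, G)` for matrix fields. -/
def innerW (L G : M.MatField) : ℝ :=
  ∑ T : M.cells, cellInner T (fun ij : Fin 3 × Fin 3 => ev (L T ij.1 ij.2)) (fun ij => ev (G T ij.1 ij.2))

/-- `(u, v)` for vector fields. -/
def innerV (u v : M.VecField) : ℝ :=
  ∑ T : M.cells, cellInner T (fun i => ev (u T i)) (fun i => ev (v T i))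

/-- `(p, q)` for scalar fields. -/
def innerQ (p q : M.ScalField) : ℝ :=
  ∑ T : M.cells, cellInner T (fun _ : Unit => ev (p T)) (fun _ => ev (q T))

/-- `(f, v)` for a general vector function `f`. -/
def load (f : Pt → Pt) (v : M.VecField) : ℝ :=
  ∑ T : M.cells, cellInner T (fun i x => f x i) (fun i => ev (v T i))

/-- `(p₀, q)` for a general scalar function `p₀`. -/
def loadQ (p₀ : Pt → ℝ) (q : M.ScalField) : ℝ :=
  ∑ T : M.cells, cellInner T (fun _ : Unit => p₀) (fun _ => ev (q T))

/-- The row-wise divergence of a matrix field. -/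
def divW (G : M.MatField) : M.VecField := fun T i => ∑ j, dd j (G T i j)

/-- The gradient of a scalar field. -/
def gradQ (q : M.ScalField) : M.VecField := fun T i => dd i (q T)

/-- `⟪a, b⟫`, the sum over all cells of the integral of `a · b` over the boundary of the cell with
respect to surface measure; `a` and `b` are vector functions on the faces of each cell. -/
def bdInner (a b : M.cells → M.facets → Pt → Fin 3 → ℝ) : ℝ :=
  ∑ T : M.cells, ∑ F ∈ M.facetsOf T, ∫ x in hull F, ∑ i, a T F x i * b T F x i ∂μHE[2]

/-- A skeleton function on the boundaries of the cells (the same on both sides of a face). -/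
def ofSkel (lam : M.SkelField) : M.cells → M.facets → Pt → Fin 3 → ℝ := fun _ F x => lam F x

/-- The trace of a vector field on the boundaries of the cells. -/
def trV (v : M.VecField) : M.cells → M.facets → Pt → Fin 3 → ℝ := fun T _ x i => ev (v T i) x

/-- `G ν` on the boundaries of the cells. -/
def trW (G : M.MatField) : M.cells → M.facets → Pt → Fin 3 → ℝ :=
  fun T F x i => ∑ j, ev (G T i j) x * normal T F j

/-- `q ν` on the boundaries of the cells. -/
def trQ (q : M.ScalField) : M.cells → M.facets → Pt → Fin 3 → ℝ :=
  fun T F x i => ev (q T) x * normal T F i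

/-- A choice of one distinguished face of every cell. -/
structure StarChoice where
  face : M.cells → M.facets
  mem : ∀ T, face T ∈ M.facetsOf T

variable {M}

open Classical in
/-- `S (u - λ)` on the boundaries of the cells: on the boundary of `T`, the stabilization is `τ` times
the identity on the distinguished face of `T` and zero on the other faces of `T`. -/
def stab (star : M.StarChoice) (τ : ℝ) (u : M.VecField) (lam : M.SkelField) :
    M.cells → M.facets → Pt → Fin 3 → ℝ :=
  fun T F x i => (if F = star.face T then τ else 0) * (ev (u T i) x - lam F x i)

/-- One step of the augmented Lagrangian SFH scheme: `(L, u, p, λ)` is a discrete solution for the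
time step size `dt`, right-hand side `f` and pressure `pOld` of the previous step. -/
structure SolvesStep (star : M.StarChoice) (k : ℕ) (τ dt : ℝ) (f : Pt → Pt) (pOld : M.ScalField)
    (L : M.MatField) (u : M.VecField) (p : M.ScalField) (lam : M.SkelField) : Prop where
  L_mem : L ∈ M.W k
  u_mem : u ∈ M.V k
  p_mem : p ∈ M.Q k
  lam_mem : lam ∈ M.Tr k
  eq_gradient : ∀ G ∈ M.W k,
    M.innerW L G + M.innerV u (M.divW G) - M.bdInner (M.ofSkel lam) (M.trW G) = 0
  eq_momentum : ∀ v ∈ M.V k,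
    M.innerV (-M.divW L + M.gradQ p) v + M.bdInner (stab star τ u lam) (M.trV v) = M.load f v
  eq_pressure : ∀ q ∈ M.Q k,
    1 / dt * M.innerQ p q - M.innerV u (M.gradQ q) + M.bdInner (M.ofSkel lam) (M.trQ q)
      = 1 / dt * M.innerQ pOld q
  eq_flux : ∀ mu ∈ M.Tr k,
    M.bdInner (-M.trW L + M.trQ p + stab star τ u lam) (M.ofSkel mu) = 0

/-- `p n`, `n ≥ 0`, and `L n`, `u n`, `lam n`, `n ≥ 1`, are the iterates of the augmented Lagrangian
SFH scheme; `p 0` is the `L²` projection of `p₀`. The values `L 0`, `u 0`, `lam 0` have no meaning. -/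
structure IsIteration (star : M.StarChoice) (k : ℕ) (τ dt : ℝ) (f : Pt → Pt) (p₀ : Pt → ℝ)
    (L : ℕ → M.MatField) (u : ℕ → M.VecField) (p : ℕ → M.ScalField) (lam : ℕ → M.SkelField) :
    Prop where
  init_mem : p 0 ∈ M.Q k
  init_eq : ∀ q ∈ M.Q k, M.innerQ (p 0) q = M.loadQ p₀ q
  step : ∀ n, SolvesStep star k τ dt f (p n) (L (n + 1)) (u (n + 1)) (p (n + 1)) (lam (n + 1))

variable (M) in
/-- On every cell `T`, `f` is `L²`-orthogonal to all `v ∈ [P_k(T)]^3` which are themselves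
`L²`-orthogonal to `[P_{k-1}(T)]^3` (where `P_{-1} = {0}`). Equivalently, on every cell the `L²`
projection of `f` onto `[P_k(T)]^3` belongs to `[P_{k-1}(T)]^3`. -/
def NoTopDegree (k : ℕ) (f : Pt → Pt) : Prop :=
  ∀ T : M.cells, ∀ v : Fin 3 → Poly, (∀ i, v i ∈ P k) →
    (∀ w : Fin 3 → Poly, (∀ i, (w i).totalDegree < k) →
      cellInner T (fun i => ev (v i)) (fun i => ev (w i)) = 0) →
    cellInner T (fun i x => f x i) (fun i => ev (v i)) = 0

end Mesh

end StokesHDG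

end

namespace StokesHDG

open scoped RealInnerProductSpace

/-! ### Evaluation of polynomials -/

/-! The velocity enters the scheme only through `(u, ∇·G)` and `(u, ∇q)`, which see its moments
against polynomials of degree below `k`, and through the stabilization on the faces `F*_T`. By
`exists_orthogonal_lift`, every polynomial trace of degree at most `k` on `F*_T` extends to an
element of `P_k(T)` orthogonal to all polynomials of lower degree. Hence to a solution for `τ₁` one
can add such a field `w` with `τ₂ (u + w - λ) = τ₁ (u - λ)` on every `F*_T`. All equations then hold
for `τ₂` with the same `L`, `p`, `λ` (`SolvesStep.transfer`, `SolvesStep.exists_other`), and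
uniqueness identifies the result with the solution for `τ₂`.

If `v` on a cell is orthogonal to lower degrees, the momentum equation reduces to `τ ∫_{F*} (u -
λ)·v = ∫_T f·v` (`SolvesStep.stab_eq_load`). Taking `v` with trace `u - λ` shows that `f` has no
top-degree part exactly if `u = λ` on all `F*_T` (`SolvesStep.noTopDegree_iff`). In that case the
stabilization vanishes and its size is immaterial. Conversely, if `u` is the same for `τ₁ ≠ τ₂`,
then `τ₁ I = τ₂ I = ∫_T f·v` with one and the same face integral `I`, so `I = 0`. Steps are coupled
only through the pressure, so induction gives the iteration.

Uniqueness of a step is an energy argument (`eq_zero_of_stepForm`). The homogeneous equations tested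
with their solution give `L = 0`, `p = 0` and `u = λ` on `F*_T`. The weak gradient equation then
forces `∇u = 0` and `u = λ` on all of `∂T` (`dd_eq_zero_and_trace_eq`). Finally `u² = ∂₀(x₀ u²)` on
each cell; summed over cells, the face terms cancel because normals are opposite on interior faces
and `λ = 0` on boundary faces, so `u = 0`. Existence follows by finite dimension. The divergence
theorem on a tetrahedron is derived from the cone formula `setIntegral_cone`. -/

theorem ev_add (p q : Poly) (x : Pt) : ev (p + q) x = ev p x + ev q x := by simp [ev]
theorem ev_sub (p q : Poly) (x : Pt) : ev (p - q) x = ev p x - ev q x := by simp [ev]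
theorem ev_neg (p : Poly) (x : Pt) : ev (-p) x = -ev p x := by simp [ev]
theorem ev_mul (p q : Poly) (x : Pt) : ev (p * q) x = ev p x * ev q x := by simp [ev]
theorem ev_smul (c : ℝ) (p : Poly) (x : Pt) : ev (c • p) x = c * ev p x := by simp [ev]
theorem ev_zero (x : Pt) : ev 0 x = 0 := by simp [ev]
theorem ev_one (x : Pt) : ev 1 x = 1 := by simp [ev]
theorem ev_C (c : ℝ) (x : Pt) : ev (MvPolynomial.C c) x = c := by simp [ev]
theorem ev_X (i : Fin 3) (x : Pt) : ev (MvPolynomial.X i) x = x i := by simp [ev]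
theorem ev_sum {ι : Type*} (s : Finset ι) (p : ι → Poly) (x : Pt) :
    ev (∑ i ∈ s, p i) x = ∑ i ∈ s, ev (p i) x := by simp [ev]

theorem continuous_ev (q : Poly) : Continuous (ev q) :=
  (MvPolynomial.continuous_eval q).comp (by fun_prop)

/-- The derivative of a polynomial along a line. -/
theorem hasDerivAt_ev_line (q : Poly) (a w : Pt) (t : ℝ) :
    HasDerivAt (fun t : ℝ => ev q (a + t • w)) (∑ j, w j * ev (dd j q) (a + t • w)) t := by
  induction q using MvPolynomial.induction_on with
  | C c => simpa [ev] using hasDerivAt_const t c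
  | add p q hp hq =>
    refine (hp.add hq).congr_deriv ?_ |>.congr_of_eventuallyEq (.of_forall fun t => ev_add _ _ _)
    simp [ev_add, mul_add, Finset.sum_add_distrib]
  | mul_X p i hp =>
    have hX : HasDerivAt (fun t : ℝ => ev (MvPolynomial.X i) (a + t • w)) (w i) t := by
      simpa [ev_X] using ((hasDerivAt_id t).mul_const (w i)).const_add (a i)
    refine (hp.mul hX).congr_deriv ?_ |>.congr_of_eventuallyEq (.of_forall fun t => ev_mul _ _ _)
    simp only [Derivation.leibniz, smul_eq_mul, ev_add, ev_mul, mul_add, Finset.sum_add_distrib,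
      MvPolynomial.pderiv_X, Finset.sum_mul]
    rw [add_comm]
    congr 1
    · rw [Finset.sum_eq_single i]
      · simp [ev_one]; ring
      · intro j _ hj
        simp [Pi.single_eq_of_ne' hj, ev_zero]
      · simp
    · exact Finset.sum_congr rfl fun j _ => by ring

/-! ### Cone formula -/

/-- Cylindrical coordinates with respect to a unit vector. -/
noncomputable def axisEquiv (a n : Pt) (hn : ‖n‖ = 1) : ℝ × (ℝ ∙ n)ᗮ ≃ᵐ Pt :=
  ((LinearIsometryEquiv.toSpanUnitSingleton n hn).toHomeomorph.toMeasurableEquiv.prodCongr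
    (MeasurableEquiv.refl _)).trans ((ℝ ∙ n).measurableEquivProd a).symm

theorem axisEquiv_apply (a n : Pt) (hn : ‖n‖ = 1) (x : ℝ × (ℝ ∙ n)ᗮ) :
    axisEquiv a n hn x = a + (x.1 • n + x.2) := by
  simp only [axisEquiv, MeasurableEquiv.trans_apply]
  rw [Submodule.measurableEquivProd_symm_apply]
  rw [vadd_eq_add, add_comm]
  rfl

theorem measurePreserving_axisEquiv (a n : Pt) (hn : ‖n‖ = 1) :
    MeasurePreserving (axisEquiv a n hn) := by
  have h1 := ((ℝ ∙ n).measurePreserving_measurableEquivProd a).symm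
  rw [InnerProductSpace.euclideanHausdorffMeasure_eq_volume] at h1
  refine MeasurePreserving.trans ?_ h1
  exact (LinearIsometryEquiv.toSpanUnitSingleton n hn).measurePreserving.prod
    (MeasurePreserving.id _)

theorem finrank_orthogonal (n : Pt) (hn : ‖n‖ = 1) : Module.finrank ℝ (ℝ ∙ n)ᗮ = 2 := by
  have : Fact (Module.finrank ℝ Pt = 2 + 1) := ⟨by simp⟩
  exact Submodule.finrank_orthogonal_span_singleton (by rintro rfl; simp at hn)

theorem isometry_plane (b n : Pt) : Isometry fun z : (ℝ ∙ n)ᗮ => b + (z : Pt) :=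
  (isometry_add_left b).comp isometry_subtype_coe

/-- Surface measure on a piece of a plane. -/
theorem restrict_plane (b n : Pt) (hn : ‖n‖ = 1) (K : Set Pt)
    (hK : ∀ y ∈ K, inner ℝ n (y - b) = 0) :
    (μHE[2] : Measure Pt).restrict K =
      (volume.restrict {z : (ℝ ∙ n)ᗮ | b + (z : Pt) ∈ K}).map fun z : (ℝ ∙ n)ᗮ => b + (z : Pt) := by
  have hφ := isometry_plane b n
  have hmap := hφ.map_euclideanHausdorffMeasure (d := 2)
  have hvol : (μHE[2] : Measure (ℝ ∙ n)ᗮ) = volume := by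
    rw [← InnerProductSpace.euclideanHausdorffMeasure_eq_volume, finrank_orthogonal n hn]
  have hsub : K ⊆ Set.range fun z : (ℝ ∙ n)ᗮ => b + (z : Pt) := fun y hy =>
    ⟨⟨y - b, Submodule.mem_orthogonal_singleton_iff_inner_right.2 (hK y hy)⟩, by simp⟩
  rw [← Measure.restrict_restrict_of_subset hsub, ← hmap,
    (hφ.isClosedEmbedding.measurableEmbedding).restrict_map, hvol]
  rfl

theorem setIntegral_plane (b n : Pt) (hn : ‖n‖ = 1) (K : Set Pt)
    (hK : ∀ y ∈ K, inner ℝ n (y - b) = 0) (g : Pt → ℝ) :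
    ∫ y in K, g y ∂μHE[2] = ∫ z in {z : (ℝ ∙ n)ᗮ | b + (z : Pt) ∈ K}, g (b + z) := by
  rw [restrict_plane b n hn K hK,
    (isometry_plane b n).isClosedEmbedding.measurableEmbedding.integral_map]

-- The integrand is the divergence of `q(x) (x - a)`, a field tangential to the faces through the
-- apex `a` and with constant normal factor `d` on the base. The proof slices the cone parallel to
-- the base and integrates along rays from `a`.
open scoped Pointwise in
theorem setIntegral_cone (a n : Pt) (hn : ‖n‖ = 1) {d : ℝ} (hd : 0 < d) (F : Finset Pt)
    (hFne : F.Nonempty) (hF : ∀ y ∈ F, inner ℝ n (y - a) = d) (q : Poly) :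
    ∫ x in hull (insert a F), (3 * ev q x + ∑ j, (x - a) j * ev (dd j q) x)
      = d * ∫ y in hull F, ev q y ∂μHE[2] := by
  set h : Pt → ℝ := fun x => 3 * ev q x + ∑ j, (x - a) j * ev (dd j q) x with h_def
  have hcont : Continuous h := by
    have := continuous_ev q
    have := fun j => continuous_ev (dd j q)
    fun_prop
  set K := hull F with K_def
  have hKc : IsCompact K := F.finite_toSet.isCompact_convexHull ℝ
  have hTc : IsCompact (hull (insert a F)) := (insert a F).finite_toSet.isCompact_convexHull ℝ
  have hKin : ∀ y ∈ K, inner ℝ n (y - a) = d := by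
    intro y hy
    have hc : Convex ℝ {y : Pt | inner ℝ n (y - a) = d} := by
      intro x hx y hy s t hs ht hst
      have : s • x + t • y - a = s • (x - a) + t • (y - a) := by
        rw [smul_sub, smul_sub, sub_add_sub_comm, ← add_smul, hst, one_smul]
      simp only [Set.mem_ofPred_eq] at hx hy ⊢
      rw [this, inner_add_right, inner_smul_right, inner_smul_right, hx, hy, ← add_mul, hst, one_mul]
    exact convexHull_min hF hc hy
  have hnn : inner ℝ n n = (1 : ℝ) := by rw [real_inner_self_eq_norm_sq, hn, one_pow]
  have hort : ∀ z : (ℝ ∙ n)ᗮ, inner ℝ n (z : Pt) = (0 : ℝ) := fun z =>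
    Submodule.mem_orthogonal_singleton_iff_inner_right.1 z.2
  set F' : Set (ℝ ∙ n)ᗮ := {z | a + d • n + (z : Pt) ∈ K} with F'_def
  have hF'c : IsCompact F' := by
    have hφ : Isometry fun z : (ℝ ∙ n)ᗮ => a + d • n + (z : Pt) :=
      (isometry_add_left _).comp isometry_subtype_coe
    exact hφ.isClosedEmbedding.isCompact_preimage hKc
  -- The slice of the cone at height `s` is the base scaled by `s / d`; the apex slice `s = 0` is
  -- negligible and left out.
  have hmem : ∀ s : ℝ, s ≠ 0 → ∀ z : (ℝ ∙ n)ᗮ,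
      a + (s • n + (z : Pt)) ∈ hull (insert a F) ↔ s ∈ Set.Ioc 0 d ∧ z ∈ (s / d) • F' := by
    intro s hs z
    have hsd : s / d ≠ 0 := div_ne_zero hs hd.ne'
    have hin : inner ℝ n (s • n + (z : Pt)) = s := by
      rw [inner_add_right, inner_smul_right, hnn, hort]; simp
    rw [show hull (insert a F) = convexHull ℝ (insert a (F : Set Pt)) by rw [← Finset.coe_insert],
      convexHull_insert (by simpa using hFne), convexJoin_singleton_left]
    simp only [Set.mem_iUnion, segment_eq_image', Set.mem_image, exists_prop]
    rw [Set.mem_smul_set_iff_inv_smul_mem₀ hsd]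
    constructor
    · rintro ⟨y, hy, r, hr, hry⟩
      have e1 : r • (y - a) = s • n + (z : Pt) := add_left_cancel hry
      have e2 : r * d = s := by
        rw [← hin, ← e1, inner_smul_right, hKin y hy]
      have e3 : s / d = r := by rw [← e2]; field_simp
      refine ⟨⟨?_, ?_⟩, ?_⟩
      · rcases hr.1.eq_or_lt with h0 | h0
        · exact absurd (by rw [← e2, ← h0, zero_mul]) hs
        · rw [← e2]; positivity
      · rw [← e2]; nlinarith [hr.2]
      · have : a + d • n + (((s / d)⁻¹ • z : (ℝ ∙ n)ᗮ) : Pt) = y := by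
          have h4 : (z : Pt) = r • (y - a) - s • n := by rw [e1]; abel
          have hr0 : r ≠ 0 := e3 ▸ hsd
          rw [Submodule.coe_smul, h4, e3, smul_sub, inv_smul_smul₀ hr0, ← e2, smul_smul,
            inv_mul_cancel_left₀ hr0]
          abel
        simpa only [F'_def, Set.mem_ofPred_eq, this] using hy
    · rintro ⟨hs1, hz⟩
      refine ⟨_, hz, s / d, ⟨(div_pos hs1.1 hd).le, (div_le_one hd).2 hs1.2⟩, ?_⟩
      rw [Submodule.coe_smul, add_assoc a, add_sub_cancel_left, smul_add, smul_inv_smul₀ hsd,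
        smul_smul, div_mul_cancel₀ _ hd.ne']
  have hfib : ∀ s : ℝ, s ≠ 0 →
      (∫ z : (ℝ ∙ n)ᗮ, (hull (insert a F)).indicator h (a + (s • n + (z : Pt)))) =
      (Set.Ioc 0 d).indicator (fun s => (s / d) ^ 2 *
        ∫ z in F', h (a + (s / d) • (d • n + (z : Pt)))) s := by
    intro s hs
    by_cases hsI : s ∈ Set.Ioc 0 d
    · have hsd : 0 < s / d := div_pos hsI.1 hd
      have : (fun z : (ℝ ∙ n)ᗮ => (hull (insert a F)).indicator h (a + (s • n + (z : Pt)))) =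
          ((s / d) • F').indicator (fun z : (ℝ ∙ n)ᗮ => h (a + (s • n + (z : Pt)))) := by
        ext z
        by_cases hz : z ∈ (s / d) • F'
        · rw [Set.indicator_of_mem hz, Set.indicator_of_mem ((hmem s hs z).2 ⟨hsI, hz⟩)]
        · rw [Set.indicator_of_notMem hz,
            Set.indicator_of_notMem (fun h => hz ((hmem s hs z).1 h).2)]
      rw [this, integral_indicator (hF'c.smul _).measurableSet, Set.indicator_of_mem hsI]
      have h2 := Measure.setIntegral_comp_smul_of_pos (volume : Measure (ℝ ∙ n)ᗮ)
        (fun z : (ℝ ∙ n)ᗮ => h (a + (s • n + (z : Pt)))) F' hsd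
      rw [finrank_orthogonal n hn, smul_eq_mul, eq_inv_mul_iff_mul_eq₀ (by positivity)] at h2
      rw [← h2]
      congr 2
      ext z
      rw [smul_add, smul_smul, div_mul_cancel₀ _ hd.ne', Submodule.coe_smul]
    · rw [Set.indicator_of_notMem hsI]
      have : (fun z : (ℝ ∙ n)ᗮ => (hull (insert a F)).indicator h (a + (s • n + (z : Pt)))) =
          fun _ => 0 := by
        ext z
        exact Set.indicator_of_notMem (fun h => hsI ((hmem s hs z).1 h).1) _
      rw [this, integral_zero]
  have hline : ∀ w : Pt, ∫ s in Set.Ioc 0 d, (s / d) ^ 2 * h (a + (s / d) • w) = d * ev q (a + w) := by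
    intro w
    rw [← intervalIntegral.integral_of_le hd.le]
    -- The area factor `(s / d) ^ 2` of the slices turns the integrand on a ray into an exact
    -- derivative, which is why the weight of `q` is `3`.
    have hder : ∀ s ∈ Set.uIcc 0 d, HasDerivAt (fun s : ℝ => d * ((s / d) ^ 3 * ev q (a + (s / d) • w)))
        ((s / d) ^ 2 * h (a + (s / d) • w)) s := by
      intro s _
      have h1 : HasDerivAt (fun s : ℝ => s / d) (1 / d) s := (hasDerivAt_id s).div_const d
      have h2 := (hasDerivAt_ev_line q a w (s / d)).scomp s h1
      have h3 := ((h1.pow 3).mul h2).const_mul d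
      refine h3.congr_deriv ?_
      simp only [h_def, add_sub_cancel_left, PiLp.smul_apply, smul_eq_mul, Function.comp_apply,
        mul_assoc, ← Finset.mul_sum, Pi.pow_apply]
      have hdd : d * (1 / d) = 1 := mul_one_div_cancel hd.ne'
      set A := ∑ x, w x * ev (dd x q) (a + (s / d) • w)
      set B := ev q (a + (s / d) • w)
      set r := s / d
      push_cast
      linear_combination (3 * r ^ 2 * B + r ^ 3 * A) * hdd
    rw [intervalIntegral.integral_eq_sub_of_hasDerivAt hder]
    · simp [div_self hd.ne']
    · exact (Continuous.intervalIntegrable (by fun_prop) _ _)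
  calc ∫ x in hull (insert a F), h x
      = ∫ x : Pt, (hull (insert a F)).indicator h x := (integral_indicator hTc.measurableSet).symm
    _ = ∫ x : ℝ × (ℝ ∙ n)ᗮ, (hull (insert a F)).indicator h (a + (x.1 • n + x.2)) := by
        rw [← (measurePreserving_axisEquiv a n hn).integral_comp']
        simp only [axisEquiv_apply]
    _ = ∫ s : ℝ, ∫ z : (ℝ ∙ n)ᗮ, (hull (insert a F)).indicator h (a + (s • n + (z : Pt))) := by
        refine integral_prod _ ?_
        have hint : Integrable ((hull (insert a F)).indicator h) :=
          (integrable_indicator_iff hTc.measurableSet).2 (hcont.continuousOn.integrableOn_compact hTc)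
        have := ((measurePreserving_axisEquiv a n hn).integrable_comp_emb
          (axisEquiv a n hn).measurableEmbedding).2 hint
        rw [← Measure.volume_eq_prod]
        simpa only [Function.comp_def, axisEquiv_apply] using this
    _ = ∫ s in Set.Ioc 0 d, (s / d) ^ 2 * ∫ z in F', h (a + (s / d) • (d • n + (z : Pt))) := by
        rw [← integral_indicator measurableSet_Ioc]
        refine integral_congr_ae ?_
        filter_upwards [Measure.ae_ne volume (0 : ℝ)] with s hs using hfib s hs
    _ = ∫ s in Set.Ioc 0 d, ∫ z in F', (s / d) ^ 2 * h (a + (s / d) • (d • n + (z : Pt))) := by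
        simp only [integral_const_mul]
    _ = ∫ z in F', ∫ s in Set.Ioc 0 d, (s / d) ^ 2 * h (a + (s / d) • (d • n + (z : Pt))) := by
        refine integral_integral_swap ?_
        rw [Measure.prod_restrict]
        refine IntegrableOn.mono_set (t := Set.Icc 0 d ×ˢ F') ?_
          (Set.prod_mono Set.Ioc_subset_Icc_self subset_rfl)
        refine ContinuousOn.integrableOn_compact (isCompact_Icc.prod hF'c) (Continuous.continuousOn ?_)
        simp only [Function.uncurry_def]
        fun_prop
    _ = ∫ z in F', d * ev q (a + d • n + (z : Pt)) := by
        simp only [hline, add_assoc]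
    _ = d * ∫ y in K, ev q y ∂μHE[2] := by
        rw [integral_const_mul, setIntegral_plane (a + d • n) n hn K]
        intro y hy
        rw [← sub_sub, inner_sub_right, hKin y hy, inner_smul_right, hnn, mul_one, sub_self]

/-! ### Simplices -/

theorem isCompact_hull (s : Finset Pt) : IsCompact (hull s) := s.finite_toSet.isCompact_convexHull ℝ

theorem measurableSet_hull (s : Finset Pt) : MeasurableSet (hull s) :=
  (isCompact_hull s).measurableSet

theorem integrableOn_hull (s : Finset Pt) {g : Pt → ℝ} (hg : Continuous g) :
    IntegrableOn g (hull s) :=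
  hg.continuousOn.integrableOn_compact (isCompact_hull s)

/-- A continuous function which is nonnegative on a convex body and has integral zero vanishes
there. -/
theorem eq_zero_of_setIntegral_eq_zero {E : Type*} [NormedAddCommGroup E] [NormedSpace ℝ E]
    [MeasurableSpace E] [BorelSpace E] {μ : Measure E} [μ.IsOpenPosMeasure]
    [IsFiniteMeasureOnCompacts μ] {K : Set E} (hK : IsCompact K) (hc : Convex ℝ K)
    (hi : (interior K).Nonempty) {g : E → ℝ} (hg : Continuous g) (h0 : ∀ x ∈ K, 0 ≤ g x)
    (hint : ∫ x in K, g x ∂μ = 0) : ∀ x ∈ K, g x = 0 := by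
  have hae : g =ᵐ[μ.restrict K] 0 := by
    rwa [← setIntegral_eq_zero_iff_of_nonneg_ae]
    · exact (ae_restrict_iff' hK.measurableSet).2 (.of_forall h0)
    · exact hg.continuousOn.integrableOn_compact hK
  refine Measure.eqOn_of_ae_eq hae hg.continuousOn continuousOn_const ?_
  rw [hc.closure_interior_eq_closure_of_nonempty_interior hi]
  exact subset_closure

/-! ### Geometry of one tetrahedron and its divergence theorem. -/

section Tetrahedron

variable {T : Finset Pt} (hT : AffineIndependent ℝ ((↑) : T → Pt)) (hcard : T.card = 4)
include hT hcard

theorem affineSpan_tetrahedron : affineSpan ℝ (T : Set Pt) = ⊤ := by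
  have := (hT.affineSpan_eq_top_iff_card_eq_finrank_add_one).2 (by simp [hcard])
  simpa using this

theorem interior_hull_nonempty : (interior (hull T)).Nonempty :=
  interior_convexHull_nonempty_iff_affineSpan_eq_top.2 (affineSpan_tetrahedron hT hcard)

/-- A polynomial vanishing on a tetrahedron is zero. -/
theorem eq_zero_of_ev_eq_zero {q : Poly} (h : ∀ x ∈ hull T, ev q x = 0) : q = 0 := by
  obtain ⟨x, hx⟩ := interior_hull_nonempty hT hcard
  have hopen : IsOpen (WithLp.ofLp '' interior (hull T) : Set (Fin 3 → ℝ)) :=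
    (PiLp.homeomorph 2 _).isOpenMap _ isOpen_interior
  obtain ⟨ε, hε, hball⟩ := Metric.isOpen_iff.1 hopen _ ⟨x, hx, rfl⟩
  refine MvPolynomial.funext_set (fun i => Metric.ball (x i) ε) (fun i => ?_) fun y hy => ?_
  · rw [Real.ball_eq_Ioo]; exact Set.Ioo_infinite (by linarith)
  · rw [← ball_pi _ hε] at hy
    obtain ⟨z, hz, rfl⟩ := hball hy
    simpa [ev] using h z (interior_subset hz)

theorem eq_zero_of_integral_ev_eq_zero {q : Poly} (h0 : ∀ x ∈ hull T, 0 ≤ ev q x)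
    (h : ∫ x in hull T, ev q x = 0) : q = 0 :=
  eq_zero_of_ev_eq_zero hT hcard <| eq_zero_of_setIntegral_eq_zero (isCompact_hull T)
    (convex_convexHull ℝ _) (interior_hull_nonempty hT hcard) (continuous_ev q) h0 h

/-- The outward normal is a unit vector orthogonal to the face, on the side opposite to the
remaining vertex. -/
theorem normal_spec {a : Pt} (ha : a ∈ T) : ‖normal T (T.erase a)‖ = 1 ∧
    ∃ d : ℝ, 0 < d ∧ ∀ y ∈ T.erase a, inner ℝ (normal T (T.erase a)) (y - a) = d := by
  set F := T.erase a with hF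
  have hFc : F.card = 3 := by rw [hF, Finset.card_erase_of_mem ha, hcard]
  set D := vectorSpan ℝ (F : Set Pt)
  -- This gives `4 (c_F - c_T) = c_F - a`, which differs from `y - a` by a direction of the face for
  -- every vertex `y` of `F`. Hence the height of `a` over the face is `4 ‖w‖`.
  have hcent : (4 : ℝ) • T.centroid ℝ id = (3 : ℝ) • F.centroid ℝ id + a := by
    rw [Finset.centroid_def, Finset.centroid_def,
      Finset.affineCombination_eq_linear_combination _ _ _
        (T.sum_centroidWeights_eq_one_of_card_ne_zero ℝ (by simp [hcard])),
      Finset.affineCombination_eq_linear_combination _ _ _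
        (F.sum_centroidWeights_eq_one_of_card_ne_zero ℝ (by simp [hFc]))]
    simp only [Finset.centroidWeights_apply, hcard, hFc, id]
    rw [← Finset.smul_sum, ← Finset.smul_sum, ← Finset.add_sum_erase _ _ ha, Nat.cast_ofNat,
      Nat.cast_ofNat, smul_inv_smul₀ (by norm_num), smul_inv_smul₀ (by norm_num), add_comm]
  obtain ⟨y₀, hy₀⟩ : F.Nonempty := Finset.card_pos.1 (by omega)
  have hcF : F.centroid ℝ id ∈ affineSpan ℝ (F : Set Pt) :=
    convexHull_subset_affineSpan _ (F.centroid_mem_convexHull ⟨y₀, hy₀⟩)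
  set w := Dᗮ.starProjection (F.centroid ℝ id - T.centroid ℝ id) with hw
  have hwD : w ∈ Dᗮ := Submodule.starProjection_apply_mem _ _
  have hwy : ∀ y ∈ F, ∃ z ∈ D, (4 : ℝ) • (F.centroid ℝ id - T.centroid ℝ id) = (y - a) + z := by
    intro y hy
    refine ⟨F.centroid ℝ id - y, vsub_mem_vectorSpan_of_mem_affineSpan_of_mem_affineSpan hcF
      (subset_affineSpan ℝ _ hy), ?_⟩
    rw [smul_sub, hcent]
    module
  have hin : ∀ y ∈ F, inner ℝ w (y - a) = 4 * ‖w‖ ^ 2 := by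
    intro y hy
    obtain ⟨z, hz, hzy⟩ := hwy y hy
    have h1 : inner ℝ w (y - a) = inner ℝ w ((4 : ℝ) • (F.centroid ℝ id - T.centroid ℝ id)) := by
      rw [hzy, inner_add_right, Submodule.inner_left_of_mem_orthogonal hz hwD, add_zero]
    rw [h1, inner_smul_right, ← real_inner_self_eq_norm_sq]
    congr 1
    rw [← Submodule.starProjection_eq_self_iff.2 hwD, Submodule.inner_starProjection_left_eq_right,
      Submodule.starProjection_eq_self_iff.2 hwD]
  have hw0 : w ≠ 0 := by
    intro h0
    obtain ⟨z, hz, hzy⟩ := hwy y₀ hy₀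
    have h1 : (4 : ℝ) • (F.centroid ℝ id - T.centroid ℝ id) ∈ D := by
      rw [← Submodule.orthogonal_orthogonal D]
      exact Submodule.smul_mem _ _ ((Submodule.starProjection_apply_eq_zero_iff _).1 h0)
    have h2 : y₀ - a ∈ D := by
      have := D.sub_mem h1 hz
      rwa [hzy, add_sub_cancel_right] at this
    have h3 : a ∈ affineSpan ℝ (F : Set Pt) := by
      have := AffineSubspace.vadd_mem_of_mem_direction (s := affineSpan ℝ (F : Set Pt))
        (by rw [direction_affineSpan]; exact D.neg_mem h2) (subset_affineSpan ℝ _ hy₀)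
      simpa using this
    have h4 := hT.notMem_affineSpan_sdiff ⟨a, ha⟩ Set.univ
    refine h4 ?_
    convert h3 using 2
    ext x
    simp [hF, and_comm]
  have hwp : 0 < ‖w‖ := norm_pos_iff.2 hw0
  refine ⟨NormedSpace.norm_normalize_eq_one_iff.2 hw0, 4 * ‖w‖, by positivity, fun y hy => ?_⟩
  change inner ℝ (NormedSpace.normalize w) (y - a) = _
  rw [NormedSpace.normalize, inner_smul_left, hin y hy]
  simp
  field_simp

theorem norm_normal {a : Pt} (ha : a ∈ T) : ‖normal T (T.erase a)‖ = 1 :=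
  (normal_spec hT hcard ha).1

theorem inner_normal_eq_zero {a y z : Pt} (ha : a ∈ T) (hy : y ∈ T.erase a) (hz : z ∈ T.erase a) :
    inner ℝ (normal T (T.erase a)) (y - z) = 0 := by
  obtain ⟨-, d, -, h⟩ := normal_spec hT hcard ha
  rw [← sub_sub_sub_cancel_right y z a, inner_sub_right, h y hy, h z hz, sub_self]

/-- Identities linear in a direction need only be checked on the edges at one vertex, where most
faces contribute nothing. -/
theorem span_edges {b : Pt} (hb : b ∈ T) :
    Submodule.span ℝ {t : Pt | ∃ a ∈ T.erase b, t = a - b} = ⊤ := by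
  have h1 : vectorSpan ℝ (T : Set Pt) = ⊤ := by
    rw [← direction_affineSpan, affineSpan_tetrahedron hT hcard, AffineSubspace.direction_top]
  rw [eq_top_iff, ← h1, vectorSpan_eq_span_vsub_set_right ℝ (Finset.mem_coe.2 hb),
    Submodule.span_le]
  rintro _ ⟨a, ha, rfl⟩
  by_cases hab : a = b
  · subst hab; simp
  · exact Submodule.subset_span ⟨a, Finset.mem_erase.2 ⟨hab, ha⟩, rfl⟩

/-- The derivative of a polynomial in a fixed direction. -/
theorem integral_edge_derivative {a b : Pt} (ha : a ∈ T) (hb : b ∈ T) (hab : a ≠ b) (q : Poly) :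
    ∫ x in hull T, ∑ j, (a - b) j * ev (dd j q) x =
      ∑ c ∈ T, inner ℝ (normal T (T.erase c)) (a - b) * ∫ y in hull (T.erase c), ev q y ∂μHE[2] := by
  have hne : ∀ c ∈ T, (T.erase c).Nonempty := fun c hc =>
    Finset.card_pos.1 (by rw [Finset.card_erase_of_mem hc, hcard]; norm_num)
  have cone : ∀ c ∈ T, ∀ e ∈ T.erase c,
      ∫ x in hull T, (3 * ev q x + ∑ j, (x - c) j * ev (dd j q) x) =
      inner ℝ (normal T (T.erase c)) (e - c) * ∫ y in hull (T.erase c), ev q y ∂μHE[2] := by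
    intro c hc e he
    obtain ⟨h1, d, hd, h⟩ := normal_spec hT hcard hc
    rw [h e he, ← setIntegral_cone c _ h1 hd _ (hne c hc) h, Finset.insert_erase hc]
  have hcont : ∀ c : Pt, Continuous fun x => 3 * ev q x + ∑ j, (x - c) j * ev (dd j q) x := by
    intro c
    have := continuous_ev q
    have := fun j => continuous_ev (dd j q)
    fun_prop
  have ha' : a ∈ T.erase b := Finset.mem_erase.2 ⟨hab, ha⟩
  have hb' : b ∈ T.erase a := Finset.mem_erase.2 ⟨hab.symm, hb⟩
  -- Subtracting the cone formulas with apexes `b` and `a` cancels the term `3 q` and leaves the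
  -- constant direction `a - b`. Faces other than those opposite `a` and `b` contain the edge, so
  -- their normals are orthogonal to it.
  calc _ = ∫ x in hull T, ((3 * ev q x + ∑ j, (x - b) j * ev (dd j q) x) -
        (3 * ev q x + ∑ j, (x - a) j * ev (dd j q) x)) := by
        congr 1
        ext x
        rw [add_sub_add_left_eq_sub, ← Finset.sum_sub_distrib]
        refine Finset.sum_congr rfl fun j _ => ?_
        simp only [PiLp.sub_apply]
        ring
    _ = inner ℝ (normal T (T.erase b)) (a - b) * ∫ y in hull (T.erase b), ev q y ∂μHE[2] -
        inner ℝ (normal T (T.erase a)) (b - a) * ∫ y in hull (T.erase a), ev q y ∂μHE[2] := by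
        rw [integral_sub (integrableOn_hull T (hcont b)) (integrableOn_hull T (hcont a)),
          cone b hb a ha', cone a ha b hb']
    _ = _ := by
        rw [← Finset.add_sum_erase _ _ ha, ← Finset.add_sum_erase _ _ hb', Finset.sum_eq_zero,
          ← neg_sub a b, inner_neg_right]
        · ring
        · intro c hc
          obtain ⟨hcb, hca, hc⟩ : c ≠ b ∧ c ≠ a ∧ c ∈ T := by simpa using hc
          rw [inner_normal_eq_zero hT hcard hc (Finset.mem_erase.2 ⟨hca.symm, ha⟩)
            (Finset.mem_erase.2 ⟨hcb.symm, hb⟩), zero_mul]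

/-- The divergence theorem on a tetrahedron, for a polynomial times a constant vector. -/
theorem integral_derivative (t : Pt) (q : Poly) :
    ∫ x in hull T, ∑ j, t j * ev (dd j q) x =
      ∑ c ∈ T, inner ℝ (normal T (T.erase c)) t * ∫ y in hull (T.erase c), ev q y ∂μHE[2] := by
  obtain ⟨b, hb⟩ : T.Nonempty := Finset.card_pos.1 (by omega)
  have hint : ∀ t : Pt, IntegrableOn (fun x => ∑ j, t j * ev (dd j q) x) (hull T) := fun t => by
    refine integrableOn_hull T ?_
    have := fun j => continuous_ev (dd j q)
    fun_prop
  have ht : t ∈ Submodule.span ℝ {t : Pt | ∃ a ∈ T.erase b, t = a - b} := by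
    rw [span_edges hT hcard hb]; trivial
  induction ht using Submodule.span_induction with
  | mem t ht =>
    obtain ⟨a, ha, rfl⟩ := ht
    exact integral_edge_derivative hT hcard (Finset.mem_of_mem_erase ha) hb (Finset.ne_of_mem_erase ha) q
  | zero => simp
  | add s t _ _ hs ht =>
    simp only [PiLp.add_apply, add_mul, Finset.sum_add_distrib, inner_add_right]
    rw [integral_add (hint s) (hint t), hs, ht]
  | smul r t _ ht =>
    simp only [PiLp.smul_apply, smul_eq_mul, mul_assoc, ← Finset.mul_sum, inner_smul_right]
    rw [integral_const_mul, ht]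

theorem inner_normal_hull {a b y : Pt} (ha : a ∈ T) (hb : b ∈ T.erase a) (hy : y ∈ hull (T.erase a)) :
    inner ℝ (normal T (T.erase a)) (y - b) = 0 := by
  refine convexHull_min (t := {y | inner ℝ (normal T (T.erase a)) (y - b) = 0})
    (fun y hy => inner_normal_eq_zero hT hcard ha hy hb) ?_ hy
  intro x hx y hy s t _ _ hst
  have : s • x + t • y - b = s • (x - b) + t • (y - b) := by
    rw [smul_sub, smul_sub, sub_add_sub_comm, ← add_smul, hst, one_smul]
  simp only [Set.mem_ofPred_eq] at hx hy ⊢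
  rw [this, inner_add_right, inner_smul_right, inner_smul_right, hx, hy, mul_zero, mul_zero,
    add_zero]

/-- Every face is an isometric copy of a planar convex body. -/
theorem exists_face_chart {a : Pt} (ha : a ∈ T) :
    ∃ (n b : Pt) (F' : Set (ℝ ∙ n)ᗮ), IsCompact F' ∧ Convex ℝ F' ∧ (interior F').Nonempty ∧
      ((fun z : (ℝ ∙ n)ᗮ => b + (z : Pt)) '' F' = hull (T.erase a)) ∧
      (μHE[2] : Measure Pt).restrict (hull (T.erase a)) =
        (volume.restrict F').map fun z : (ℝ ∙ n)ᗮ => b + (z : Pt) := by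
  set F := T.erase a with hF
  have hFc : F.card = 3 := by rw [hF, Finset.card_erase_of_mem ha, hcard]
  obtain ⟨b, hb⟩ : F.Nonempty := Finset.card_pos.1 (by omega)
  set n := normal T F with n_def
  have hn : ‖n‖ = 1 := norm_normal hT hcard ha
  have hFin : ∀ y ∈ hull F, y - b ∈ (ℝ ∙ n)ᗮ := fun y hy =>
    Submodule.mem_orthogonal_singleton_iff_inner_right.2 (inner_normal_hull hT hcard ha hb hy)
  let φ : (ℝ ∙ n)ᗮ →ᵃ[ℝ] Pt := (ℝ ∙ n)ᗮ.subtype.toAffineMap + AffineMap.const ℝ _ b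
  have hφ : ∀ z, φ z = b + z := fun z => by simp [φ, add_comm]
  have hφi : Isometry φ := by
    rw [show (φ : (ℝ ∙ n)ᗮ → Pt) = fun z : (ℝ ∙ n)ᗮ => b + (z : Pt) from funext hφ]
    exact isometry_plane b n
  set F' := φ ⁻¹' hull F with F'_def
  have hF'c : IsCompact F' := hφi.isClosedEmbedding.isCompact_preimage (isCompact_hull F)
  have hconv : Convex ℝ F' := (convex_convexHull ℝ _).affine_preimage φ
  let p : F → (ℝ ∙ n)ᗮ := fun y => ⟨y - b, hFin y (subset_convexHull ℝ _ y.2)⟩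
  have hp : ∀ y, φ (p y) = y := fun y => by rw [hφ]; simp [p]
  have hind : AffineIndependent ℝ p := by
    refine AffineIndependent.of_comp φ ?_
    have : φ ∘ p = ((↑) : T → Pt) ∘ fun y : F => ⟨y, Finset.mem_of_mem_erase y.2⟩ := funext hp
    rw [this]
    exact hT.comp_embedding ⟨fun y : F => (⟨y, Finset.mem_of_mem_erase y.2⟩ : T),
      fun y z h => Subtype.ext (congrArg (fun x : T => (x : Pt)) h)⟩
  have hspan : affineSpan ℝ (Set.range p) = ⊤ :=
    (hind.affineSpan_eq_top_iff_card_eq_finrank_add_one).2 (by simp [hFc, finrank_orthogonal n hn])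
  have hint : (interior F').Nonempty := by
    refine (interior_convexHull_nonempty_iff_affineSpan_eq_top.2 hspan).mono (interior_mono ?_)
    refine convexHull_min ?_ hconv
    rintro _ ⟨y, rfl⟩
    change φ (p y) ∈ hull F
    rw [hp]
    exact subset_convexHull ℝ _ y.2
  have hF'eq : F' = {z : (ℝ ∙ n)ᗮ | b + (z : Pt) ∈ hull F} := by
    ext z; rw [F'_def, Set.mem_preimage, hφ]; rfl
  refine ⟨n, b, F', hF'c, hconv, hint, ?_, ?_⟩
  · ext y
    constructor
    · rintro ⟨z, hz, rfl⟩
      rwa [hF'eq] at hz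
    · exact fun hy => ⟨⟨y - b, hFin y hy⟩, by rw [hF'eq]; simpa using hy, by simp⟩
  · rw [hF'eq]
    exact restrict_plane b n hn _ fun y hy => inner_normal_hull hT hcard ha hb hy

theorem integrableOn_face {a : Pt} (ha : a ∈ T) {g : Pt → ℝ} (hg : Continuous g) :
    IntegrableOn g (hull (T.erase a)) μHE[2] := by
  obtain ⟨n, b, F', hc, -, -, -, h⟩ := exists_face_chart hT hcard ha
  rw [IntegrableOn, h, (isometry_plane b n).isClosedEmbedding.measurableEmbedding.integrable_map_iff]
  exact (hg.comp (isometry_plane b n).continuous).continuousOn.integrableOn_compact hc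

theorem eq_zero_of_face_integral_eq_zero {a : Pt} (ha : a ∈ T) {g : Pt → ℝ} (hg : Continuous g)
    (h0 : ∀ x, 0 ≤ g x) (hint : ∫ x in hull (T.erase a), g x ∂μHE[2] = 0) :
    ∀ x ∈ hull (T.erase a), g x = 0 := by
  obtain ⟨n, b, F', hc, hconv, hi, him, h⟩ := exists_face_chart hT hcard ha
  rw [h, (isometry_plane b n).isClosedEmbedding.measurableEmbedding.integral_map] at hint
  rw [← him]
  rintro _ ⟨z, hz, rfl⟩
  exact eq_zero_of_setIntegral_eq_zero hc hconv hi (hg.comp (isometry_plane b n).continuous)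
    (fun z _ => h0 _) hint z hz

end Tetrahedron

/-! ### Opposite normals on a common face. -/

/-- Two tetrahedra which meet exactly in a common face have opposite normals there. -/
theorem normal_eq_neg_normal {T T' : Finset Pt} (hT : AffineIndependent ℝ ((↑) : T → Pt))
    (hcard : T.card = 4) (hT' : AffineIndependent ℝ ((↑) : T' → Pt)) (hcard' : T'.card = 4)
    {a b : Pt} (ha : a ∈ T) (hb : b ∈ T') (hF : T.erase a = T'.erase b)
    (hint : hull T ∩ hull T' ⊆ hull (T.erase a)) :
    normal T (T.erase a) = -normal T' (T.erase a) := by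
  obtain ⟨hn, d, hd, hnd⟩ := normal_spec hT hcard ha
  obtain ⟨hn', d', hd', hnd'⟩ := normal_spec hT' hcard' hb
  have horth' : ∀ y ∈ T.erase a, ∀ z ∈ T.erase a, inner ℝ (normal T' (T.erase a)) (y - z) = 0 := by
    rw [hF]
    exact fun y hy z hz => inner_normal_eq_zero hT' hcard' hb hy hz
  rw [← hF] at hn' hnd'
  have horth : ∀ y ∈ T.erase a, ∀ z ∈ T.erase a, inner ℝ (normal T (T.erase a)) (y - z) = 0 :=
    fun y hy z hz => inner_normal_eq_zero hT hcard ha hy hz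
  set F := T.erase a with F_def
  set n := normal T F
  set n' := normal T' F
  have hFc : F.card = 3 := by rw [F_def, Finset.card_erase_of_mem ha, hcard]
  obtain ⟨y₀, hy₀⟩ : F.Nonempty := Finset.card_pos.1 (by omega)
  have hperp : ∀ m : Pt, (∀ y ∈ F, ∀ z ∈ F, inner ℝ m (y - z) = 0) → m ∈ (vectorSpan ℝ (F : Set Pt))ᗮ := by
    intro m hm
    rw [vectorSpan_def, Submodule.mem_orthogonal']
    intro u hu
    induction hu using Submodule.span_induction with
    | mem u hu =>
      obtain ⟨y, hy, z, hz, rfl⟩ := hu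
      exact hm y hy z hz
    | zero => simp
    | add u v _ _ hu hv => rw [inner_add_right, hu, hv, add_zero]
    | smul r u _ hu => rw [inner_smul_right, hu, mul_zero]
  -- The normal space of a triangle is a line, so the two unit normals agree up to sign.
  have hrank : Module.finrank ℝ (vectorSpan ℝ (F : Set Pt))ᗮ = 1 := by
    have hind : AffineIndependent ℝ ((↑) : F → Pt) :=
      hT.mono (fun x hx => Finset.mem_of_mem_erase hx)
    have h1 := hind.finrank_vectorSpan (n := 2) (by simp [hFc])
    rw [Subtype.range_coe_subtype] at h1
    have h2 := (vectorSpan ℝ (F : Set Pt)).finrank_add_finrank_orthogonal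
    have h3 : Module.finrank ℝ Pt = 3 := by simp
    have h4 : Module.finrank ℝ (vectorSpan ℝ (F : Set Pt)) = 2 := h1
    omega
  have hn0 : (⟨n, hperp n horth⟩ : (vectorSpan ℝ (F : Set Pt))ᗮ) ≠ 0 := by
    intro h
    have : n = 0 := congrArg Subtype.val h
    simp [this] at hn
  obtain ⟨r, hr⟩ := (finrank_eq_one_iff_of_nonzero' _ hn0).1 hrank ⟨n', hperp n' horth'⟩
  replace hr : r • n = n' := congrArg Subtype.val hr
  have hr1 : |r| = 1 := by
    rw [← hn', ← hr, norm_smul, hn, mul_one, Real.norm_eq_abs]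
  rcases eq_or_eq_neg_of_abs_eq hr1 with h1 | h1
  swap
  · rw [← hr, h1, neg_smul, one_smul, neg_neg]
  -- Equal normals would put `a` and `b` on the same side of the face. Then a point slightly off the
  -- centroid of the face towards `a` lies in both tetrahedra but not in the plane of the face.
  exfalso
  rw [h1, one_smul] at hr
  rw [← hr] at hnd'
  -- barycentric coordinates with respect to `T'`
  let B : AffineBasis T' ℝ Pt := ⟨((↑) : T' → Pt), hT', by
    rw [Subtype.range_coe_subtype]; exact affineSpan_tetrahedron hT' hcard'⟩
  have hBr : Set.range B = (T' : Set Pt) := Subtype.range_coe_subtype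
  have hFT' : ∀ y ∈ F, y ∈ T' := fun y hy => Finset.mem_of_mem_erase (hF ▸ hy)
  let c : Pt := F.centroid ℝ id
  have hc : ∀ i : T', B.coord i c = if (i : Pt) = b then 0 else 1 / 3 := by
    intro i
    rw [show c = F.affineCombination ℝ id (F.centroidWeights ℝ) from F.centroid_def ℝ id,
      Finset.map_affineCombination _ _ _
        (F.sum_centroidWeights_eq_one_of_card_ne_zero ℝ (by simp [hFc])),
      Finset.affineCombination_eq_linear_combination _ _ _
        (F.sum_centroidWeights_eq_one_of_card_ne_zero ℝ (by simp [hFc]))]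
    have h1 : ∀ y ∈ F, F.centroidWeights ℝ y • (B.coord i ∘ id) y = if y = i then 1 / 3 else 0 := by
      intro y hy
      have h2 : B.coord i y = if i = (⟨y, hFT' y hy⟩ : T') then 1 else 0 := B.coord_apply i ⟨y, hFT' y hy⟩
      simp only [Finset.centroidWeights_apply, hFc, Function.comp_apply, id, h2, Subtype.ext_iff,
        eq_comm (a := (i : Pt))]
      split_ifs <;> simp
    rw [Finset.sum_congr rfl h1, Finset.sum_ite_eq']
    have h3 : (i : Pt) ∈ F ↔ ¬ (i : Pt) = b := by
      rw [hF, Finset.mem_erase]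
      exact ⟨fun h => h.1, fun h => ⟨h, i.2⟩⟩
    simp only [h3, ite_not]
  -- Expanding `y₀ - a` in barycentric coordinates and pairing with `n`, only the vertex `b` off the
  -- face survives; both heights are positive.
  have hab : 0 < B.coord ⟨b, hb⟩ a := by
    have h1 : y₀ - a = ∑ i, B.coord i a • (y₀ - B i) := by
      simp only [smul_sub, Finset.sum_sub_distrib, ← Finset.sum_smul, B.sum_coord_apply_eq_one,
        one_smul, B.linear_combination_coord_eq_self]
    have h2 := hnd y₀ hy₀
    rw [h1, inner_sum, Finset.sum_eq_single (⟨b, hb⟩ : T')] at h2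
    · rw [inner_smul_right, show B ⟨b, hb⟩ = b from rfl, hnd' y₀ hy₀] at h2
      exact pos_of_mul_pos_left (h2 ▸ hd) hd'.le
    · intro i _ hi
      have hiF : (i : Pt) ∈ F := by
        rw [hF]
        exact Finset.mem_erase.2 ⟨fun h => hi (Subtype.ext h), i.2⟩
      rw [inner_smul_right, show B i = i from rfl, horth y₀ hy₀ i hiF, mul_zero]
    · simp
  -- The coordinates at the vertices of the face start at `1 / 3` and stay positive for small `ε`;
  -- the one at `b` starts at zero and grows.
  have hev : ∀ᶠ ε : ℝ in nhdsWithin 0 (Set.Ioi 0), ∀ i : T', 0 ≤ B.coord i (AffineMap.lineMap c a ε) := by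
    rw [Filter.eventually_all]
    intro i
    have hl : ∀ ε : ℝ, B.coord i (AffineMap.lineMap c a ε) =
        (1 - ε) * B.coord i c + ε * B.coord i a := fun ε => by
      rw [AffineMap.apply_lineMap, AffineMap.lineMap_apply_ring']
      ring
    simp only [hl, hc]
    split_ifs with h
    · obtain rfl : i = ⟨b, hb⟩ := Subtype.ext h
      filter_upwards [self_mem_nhdsWithin] with ε hε
      rw [mul_zero, zero_add]
      exact mul_nonneg (le_of_lt hε) hab.le
    · refine Filter.Eventually.filter_mono nhdsWithin_le_nhds ?_
      have hcont : Continuous fun ε : ℝ => (1 - ε) * (1 / 3) + ε * B.coord i a := by fun_prop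
      have h0 := hcont.tendsto 0
      filter_upwards [h0.eventually (lt_mem_nhds (a := 0) (by norm_num))] with ε hε using hε.le
  obtain ⟨ε, hε, hε0, hε1⟩ := (hev.and (Ioo_mem_nhdsGT (zero_lt_one' ℝ))).exists
  have hcF : c ∈ hull F := F.centroid_mem_convexHull ⟨y₀, hy₀⟩
  have hx : AffineMap.lineMap c a ε ∈ hull F := by
    refine hint ⟨?_, ?_⟩
    · refine (convex_convexHull ℝ _).lineMap_mem ?_ (subset_convexHull ℝ _ ha) ⟨hε0.le, hε1.le⟩
      exact convexHull_mono (Finset.coe_subset.2 (Finset.erase_subset _ _)) hcF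
    · rw [hull, ← hBr, B.convexHull_eq_nonneg_coord]
      exact hε
  have h5 := inner_normal_hull hT hcard ha hy₀ hx
  have h6 := inner_normal_hull hT hcard ha hy₀ hcF
  have h7 : inner ℝ n (y₀ - a) = d := hnd y₀ hy₀
  change inner ℝ n _ = 0 at h5 h6
  rw [AffineMap.lineMap_apply_module', add_sub_assoc, inner_add_right, h6, inner_smul_right,
    add_zero, show a - c = -(y₀ - a) - (c - y₀) by abel, inner_sub_right, h6, inner_neg_right, h7] at h5
  nlinarith

/-! ### Incidence of cells and faces in the mesh. -/

namespace Mesh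

variable {Ω : Set Pt} (M : Mesh Ω)

theorem card_cell (T : M.cells) : (T : Finset Pt).card = 4 := (Finset.mem_filter.1 T.2).2

theorem cell_mem_faces (T : M.cells) : (T : Finset Pt) ∈ M.faces := by
  simpa using (Finset.mem_filter.1 T.2).1

theorem card_facet (F : M.facets) : (F : Finset Pt).card = 3 := (Finset.mem_filter.1 F.2).2

theorem facet_mem_faces (F : M.facets) : (F : Finset Pt) ∈ M.faces := by
  simpa using (Finset.mem_filter.1 F.2).1

theorem indep_cell (T : M.cells) : AffineIndependent ℝ ((↑) : T.1 → Pt) :=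
  M.indep (M.cell_mem_faces T)

variable {M}

theorem mem_facetsOf {T : M.cells} {F : M.facets} :
    F ∈ M.facetsOf T ↔ (F : Finset Pt) ⊆ (T : Finset Pt) := by simp [facetsOf]

theorem exists_vertex {T : M.cells} {F : M.facets} (h : F ∈ M.facetsOf T) :
    ∃ a ∈ (T : Finset Pt), (F : Finset Pt) = (T : Finset Pt).erase a := by
  have hs := mem_facetsOf.1 h
  have hc : ((T : Finset Pt) \ F).card = 1 := by
    rw [Finset.card_sdiff_of_subset hs, M.card_cell, M.card_facet]
  obtain ⟨a, ha⟩ := Finset.card_eq_one.1 hc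
  refine ⟨a, (Finset.mem_sdiff.1 (ha ▸ Finset.mem_singleton_self a : a ∈ (T : Finset Pt) \ F)).1, ?_⟩
  rw [← Finset.sdiff_singleton_eq_erase, ← ha, Finset.sdiff_sdiff_eq_self hs]

theorem exists_facet (T : M.cells) {a : Pt} (ha : a ∈ (T : Finset Pt)) :
    ∃ F ∈ M.facetsOf T, (F : Finset Pt) = (T : Finset Pt).erase a := by
  have hc : ((T : Finset Pt).erase a).card = 3 := by
    rw [Finset.card_erase_of_mem ha, M.card_cell]
  have hf : (T : Finset Pt).erase a ∈ M.faces :=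
    M.down_closed (M.cell_mem_faces T) (Finset.erase_subset _ _) (Finset.card_pos.1 (by omega))
  exact ⟨⟨_, Finset.mem_filter.2 ⟨by simpa using hf, hc⟩⟩, mem_facetsOf.2 (Finset.erase_subset _ _), rfl⟩

/-- Faces of a cell correspond to opposite vertices; this translates between mesh sums and the
formulas for a single tetrahedron. -/
theorem sum_facetsOf (T : M.cells) (φ : Finset Pt → ℝ) :
    ∑ F ∈ M.facetsOf T, φ F = ∑ a ∈ (T : Finset Pt), φ ((T : Finset Pt).erase a) := by
  symm
  refine Finset.sum_bij (fun a ha => (exists_facet T ha).choose) (fun a ha => ?_)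
    (fun a ha b hb hab => ?_) (fun F hF => ?_) (fun a ha => ?_)
  · exact (exists_facet T ha).choose_spec.1
  · have h1 := (exists_facet T ha).choose_spec.2
    have h2 := (exists_facet T hb).choose_spec.2
    rw [hab] at h1
    exact Finset.erase_injOn _ ha hb (h1.symm.trans h2)
  · obtain ⟨a, ha, h⟩ := exists_vertex hF
    exact ⟨a, ha, Subtype.ext ((exists_facet T ha).choose_spec.2.trans h.symm)⟩
  · rw [(exists_facet T ha).choose_spec.2]

theorem exists_cell (F : M.facets) : ∃ T : M.cells, F ∈ M.facetsOf T := by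
  obtain ⟨T, hT, hs, hc⟩ := M.pure _ (M.facet_mem_faces F)
  exact ⟨⟨T, Finset.mem_filter.2 ⟨by simpa using hT, hc⟩⟩, mem_facetsOf.2 hs⟩

/-- In a simplicial complex two cells meet in the hull of their common vertices. For distinct cells
sharing `F` the vertex of `T` off `F` is not common, so they meet inside `F`. -/
theorem normal_eq_neg {T T' : M.cells} {F : M.facets} (h : F ∈ M.facetsOf T)
    (h' : F ∈ M.facetsOf T') (hne : T ≠ T') : normal T F = -normal T' F := by
  obtain ⟨a, ha, hF⟩ := exists_vertex h
  obtain ⟨b, hb, hF'⟩ := exists_vertex h'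
  rw [hF]
  refine normal_eq_neg_normal (M.indep_cell T) (M.card_cell T) (M.indep_cell T') (M.card_cell T')
    ha hb (hF.symm.trans hF') ?_
  refine (M.inter_subset_convexHull (M.cell_mem_faces T) (M.cell_mem_faces T')).trans
    (convexHull_mono ?_)
  intro x hxx
  obtain ⟨hx, hx'⟩ := hxx
  refine Finset.mem_coe.2 (Finset.mem_erase.2 ⟨?_, hx⟩)
  rintro rfl
  refine hne (Subtype.ext (Finset.eq_of_subset_of_card_le ?_ (by rw [M.card_cell, M.card_cell])))
  rw [← Finset.insert_erase ha, ← hF]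
  exact Finset.insert_subset hx' (mem_facetsOf.1 h')

-- An interior face has exactly two cells: the normal from a third would be opposite to two mutually
-- opposite vectors, hence zero.
open Classical in
theorem sum_normal_eq_zero {F : M.facets} (hF : ¬ M.IsBoundary F) :
    ∑ T : M.cells with F ∈ M.facetsOf T, normal T F = 0 := by
  obtain ⟨T₁, h₁⟩ := exists_cell F
  obtain ⟨T₂, h₂, hne⟩ : ∃ T₂, F ∈ M.facetsOf T₂ ∧ T₂ ≠ T₁ := by
    by_contra! h
    exact hF ⟨T₁, h₁, h⟩
  have : (Finset.univ.filter fun T : M.cells => F ∈ M.facetsOf T) = {T₁, T₂} := by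
    ext T
    simp only [Finset.mem_filter, Finset.mem_univ, true_and, Finset.mem_insert, Finset.mem_singleton]
    refine ⟨fun h => ?_, by rintro (rfl | rfl) <;> assumption⟩
    by_contra! hT
    have e1 := normal_eq_neg h h₁ hT.1
    have e2 := normal_eq_neg h h₂ hT.2
    have e3 := normal_eq_neg h₂ h₁ hne
    have e4 : normal T F = 0 := by
      rw [e3, neg_neg, ← neg_neg (normal T₁ F), ← e1] at e2
      have e5 : (2 : ℝ) • normal T F = 0 := by
        rw [two_smul]; nth_rewrite 1 [e2]; exact neg_add_cancel _
      exact (smul_eq_zero.1 e5).resolve_left two_ne_zero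
    obtain ⟨a, ha, hFa⟩ := exists_vertex h
    have := norm_normal (M.indep_cell T) (M.card_cell T) ha
    rw [← hFa, e4, norm_zero] at this
    exact zero_ne_one this
  rw [this, Finset.sum_pair hne.symm, normal_eq_neg h₂ h₁ hne, add_neg_cancel]

end Mesh

/-! ### Degrees -/

theorem mem_P {k : ℕ} {q : Poly} : q ∈ P k ↔ q.totalDegree ≤ k :=
  MvPolynomial.mem_restrictTotalDegree _ _ _

theorem mul_mem_P {k m : ℕ} {p q : Poly} (hp : p ∈ P k) (hq : q ∈ P m) : p * q ∈ P (k + m) :=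
  mem_P.2 ((MvPolynomial.totalDegree_mul p q).trans (add_le_add (mem_P.1 hp) (mem_P.1 hq)))

theorem totalDegree_dd (j : Fin 3) (q : Poly) : (dd j q).totalDegree ≤ q.totalDegree - 1 := by
  conv_lhs => rw [q.as_sum]
  rw [dd, map_sum]
  refine (MvPolynomial.totalDegree_finsetSum _ _).trans (Finset.sup_le fun s hs => ?_)
  rw [MvPolynomial.pderiv_monomial]
  by_cases h0 : s j = 0
  · simp [h0]
  have h1 : s - Finsupp.single j 1 + Finsupp.single j 1 = s :=
    tsub_add_cancel_of_le (Finsupp.single_le_iff.2 (Nat.one_le_iff_ne_zero.2 h0))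
  have h2 : (s.sum fun _ e => e) = ((s - Finsupp.single j 1).sum fun _ e => e) + 1 := by
    conv_lhs => rw [← h1]
    rw [Finsupp.sum_add_index' (by simp) (by simp), Finsupp.sum_single_index rfl]
  have h3 := MvPolynomial.le_totalDegree hs
  refine (MvPolynomial.totalDegree_monomial_le _ _).trans ?_
  change ((s - Finsupp.single j 1).sum fun _ e => e) ≤ _
  omega

theorem dd_mem_P {k : ℕ} {q : Poly} (hq : q ∈ P k) (j : Fin 3) : dd j q ∈ P (k - 1) :=
  mem_P.2 ((totalDegree_dd j q).trans (Nat.sub_le_sub_right (mem_P.1 hq) 1))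

theorem dd_eq_zero {q : Poly} (hq : q ∈ P 0) (j : Fin 3) : dd j q = 0 := by
  rw [MvPolynomial.totalDegree_eq_zero_iff_eq_C.1 (Nat.le_zero.1 (mem_P.1 hq))]
  exact MvPolynomial.pderiv_C

theorem dd_mul (j : Fin 3) (p q : Poly) : dd j (p * q) = dd j p * q + p * dd j q := by
  rw [dd, Derivation.leibniz, smul_eq_mul, smul_eq_mul, mul_comm q, add_comm]

/-- Directional derivative of a polynomial. -/
noncomputable def ddir (t : Pt) (q : Poly) : Poly := ∑ j, t j • dd j q

theorem ev_ddir (t : Pt) (q : Poly) (x : Pt) : ev (ddir t q) x = ∑ j, t j * ev (dd j q) x := by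
  simp [ddir, ev_sum, ev_smul]

theorem ddir_mul (t : Pt) (p q : Poly) : ddir t (p * q) = ddir t p * q + p * ddir t q := by
  simp only [ddir, Finset.sum_mul, Finset.mul_sum, ← Finset.sum_add_distrib]
  refine Finset.sum_congr rfl fun j _ => ?_
  rw [dd_mul, smul_add, mul_smul_comm, smul_mul_assoc]

theorem ddir_mem_P {k : ℕ} {q : Poly} (hq : q ∈ P k) (t : Pt) : ddir t q ∈ P (k - 1) :=
  Submodule.sum_mem _ fun j _ => Submodule.smul_mem _ _ (dd_mem_P hq j)

/-- This makes `l ∂u` an admissible test function. The case `k = 0` is separate because `k - 1`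
truncates; the derivative is then zero. -/
theorem mul_ddir_mem_P {k : ℕ} {l q : Poly} (hl : l ∈ P 1) (hq : q ∈ P k) (t : Pt) :
    l * ddir t q ∈ P k := by
  rcases Nat.eq_zero_or_pos k with rfl | hk
  · simp [ddir, dd_eq_zero hq]
  · have := mul_mem_P hl (ddir_mem_P hq t)
    rwa [Nat.add_sub_cancel' hk] at this

theorem ddir_single (j : Fin 3) (q : Poly) : ddir (EuclideanSpace.single j 1) q = dd j q := by
  simp [ddir, ite_smul]

/-! ### Integration of polynomials over cells -/

/-- The integral of a polynomial over a simplex. -/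
noncomputable def cellInt (T : Finset Pt) : Poly →ₗ[ℝ] ℝ where
  toFun q := ∫ x in hull T, ev q x
  map_add' p q := by
    simp only [ev_add]
    exact integral_add (integrableOn_hull T (continuous_ev p)) (integrableOn_hull T (continuous_ev q))
  map_smul' c q := by
    simp only [ev_smul, RingHom.id_apply, smul_eq_mul]
    exact integral_const_mul _ _

theorem cellInt_apply (T : Finset Pt) (q : Poly) : cellInt T q = ∫ x in hull T, ev q x := rfl

section Tetrahedron

variable {T : Finset Pt} (hT : AffineIndependent ℝ ((↑) : T → Pt)) (hcard : T.card = 4)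
include hT hcard

theorem eq_zero_of_cellInt_sq {q : Poly} (h : cellInt T (q * q) = 0) : q = 0 :=
  mul_self_eq_zero.1 <| eq_zero_of_integral_ev_eq_zero hT hcard
    (fun x _ => by rw [ev_mul]; exact mul_self_nonneg _) h

/-- The affine function vanishing on a face and positive on the remaining vertex. -/
theorem exists_face_poly {a : Pt} (ha : a ∈ T) :
    ∃ l ∈ P 1, l ≠ 0 ∧ (∀ x ∈ hull (T.erase a), ev l x = 0) ∧ ∀ x ∈ hull T, 0 ≤ ev l x := by
  obtain ⟨-, d, hd, h⟩ := normal_spec hT hcard ha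
  obtain ⟨y₀, hy₀⟩ : (T.erase a).Nonempty :=
    Finset.card_pos.1 (by rw [Finset.card_erase_of_mem ha, hcard]; norm_num)
  set n := normal T (T.erase a) with n_def
  have hev : ∀ x, ev (∑ j, n j • (MvPolynomial.C (y₀ j) - MvPolynomial.X j)) x =
      inner ℝ n (y₀ - x) := by
    intro x
    simp only [ev_sum, ev_smul, ev_sub, ev_C, ev_X, PiLp.inner_apply, PiLp.sub_apply]
    exact Finset.sum_congr rfl fun j _ => by simp [mul_comm]
  have hzero : ∀ y ∈ T.erase a, inner ℝ n (y₀ - y) = 0 := fun y hy =>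
    inner_normal_eq_zero hT hcard ha hy₀ hy
  refine ⟨∑ j, n j • (MvPolynomial.C (y₀ j) - MvPolynomial.X j), ?_, ?_, fun x hx => ?_, ?_⟩
  · refine Submodule.sum_mem _ fun j _ => Submodule.smul_mem _ _ (Submodule.sub_mem _ ?_ ?_)
    · exact mem_P.2 (by simp)
    · exact mem_P.2 (by simp)
  · intro h0
    have := hev a
    rw [h0, ev_zero, h y₀ hy₀] at this
    exact hd.ne this
  · rw [hev, ← neg_sub, inner_neg_right, inner_normal_hull hT hcard ha hy₀ hx, neg_zero]
  · intro x hx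
    rw [hev]
    refine convexHull_min (t := {x | 0 ≤ inner ℝ n (y₀ - x)}) ?_ ?_ hx
    · intro y hy
      by_cases hya : y = a
      · subst hya
        exact hd.le.trans_eq (h y₀ hy₀).symm
      · exact (hzero y (Finset.mem_erase.2 ⟨hya, hy⟩)).ge
    · intro x hx y hy s t hs ht hst
      have : y₀ - (s • x + t • y) = s • (y₀ - x) + t • (y₀ - y) := by
        rw [smul_sub, smul_sub, sub_add_sub_comm, ← add_smul, hst, one_smul]
      simp only [Set.mem_ofPred_eq] at hx hy ⊢
      rw [this, inner_add_right, inner_smul_right, inner_smul_right]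
      positivity

/-! ### Integration by parts and the local uniqueness argument. -/

/-- Integration by parts on a tetrahedron. -/
theorem cellInt_parts (t : Pt) (p q : Poly) :
    cellInt T (ddir t p * q) + cellInt T (p * ddir t q) =
      ∑ c ∈ T, inner ℝ (normal T (T.erase c)) t *
        ∫ y in hull (T.erase c), ev p y * ev q y ∂μHE[2] := by
  rw [← map_add, ← ddir_mul, cellInt_apply]
  simp only [ev_ddir, integral_derivative hT hcard, ev_mul]

/-- The local argument behind well-posedness: a weak gradient that vanishes, together with agreement
of the trace with the skeleton function on one face, forces a vanishing gradient and agreement of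
the traces on all faces. -/
theorem dd_eq_zero_and_trace_eq {k : ℕ} {b : Pt} (hb : b ∈ T) {u : Poly} (hu : u ∈ P k)
    {g : Pt → Poly} (hg : ∀ a ∈ T, g a ∈ P k)
    (hweak : ∀ t : Pt, ∀ q ∈ P k, cellInt T (u * ddir t q) =
      ∑ c ∈ T, inner ℝ (normal T (T.erase c)) t *
        ∫ y in hull (T.erase c), ev (g c) y * ev q y ∂μHE[2])
    (hub : ∀ x ∈ hull (T.erase b), ev u x = ev (g b) x) :
    (∀ j, dd j u = 0) ∧ ∀ a ∈ T, ∀ x ∈ hull (T.erase a), ev u x = ev (g a) x := by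
  -- In the direction `a - b` only the faces opposite `a` and `b` contribute, and on the latter the
  -- traces agree by assumption. A single boundary term remains.
  have hface : ∀ a ∈ T.erase b, ∀ q ∈ P k, cellInt T (ddir (a - b) u * q) =
      inner ℝ (normal T (T.erase a)) (a - b) *
        ∫ y in hull (T.erase a), ev (u - g a) y * ev q y ∂μHE[2] := by
    intro a ha q hq
    have h1 := cellInt_parts hT hcard (a - b) u q
    rw [hweak _ q hq, ← eq_sub_iff_add_eq, ← Finset.sum_sub_distrib] at h1
    rw [h1, Finset.sum_eq_single a]
    · rw [← mul_sub, ← integral_sub]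
      · simp only [ev_sub, sub_mul]
      · exact integrableOn_face hT hcard (Finset.mem_of_mem_erase ha)
          ((continuous_ev _).mul (continuous_ev _))
      · exact integrableOn_face hT hcard (Finset.mem_of_mem_erase ha)
          ((continuous_ev _).mul (continuous_ev _))
    · intro c hc hca
      rw [← mul_sub]
      by_cases hcb : c = b
      · subst hcb
        rw [setIntegral_congr_fun (measurableSet_hull _)
          (g := fun y => ev (g c) y * ev q y) (fun y hy => by simp only [hub y hy]), sub_self, mul_zero]
      · rw [inner_normal_eq_zero hT hcard hc (Finset.mem_erase.2 ⟨Ne.symm hca, Finset.mem_of_mem_erase ha⟩)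
          (Finset.mem_erase.2 ⟨Ne.symm hcb, hb⟩), zero_mul]
    · exact fun h => absurd (Finset.mem_of_mem_erase ha) h
  have hedge : ∀ a ∈ T.erase b, ddir (a - b) u = 0 := by
    intro a ha
    -- Testing with `l ∂u`, where `l` vanishes on the remaining face and is nonnegative on `T`,
    -- leaves `∫ l (∂u)² = 0`.
    obtain ⟨l, hl, hl0, hlF, hlT⟩ := exists_face_poly hT hcard (Finset.mem_of_mem_erase ha)
    have h1 := hface a ha (l * ddir (a - b) u) (mul_ddir_mem_P hl hu _)
    rw [setIntegral_congr_fun (measurableSet_hull _) (g := fun _ => 0)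
      (fun y hy => by simp only [ev_mul, hlF y hy, zero_mul, mul_zero]), integral_zero, mul_zero] at h1
    have h2 := eq_zero_of_integral_ev_eq_zero hT hcard (fun x hx => by
      rw [ev_mul, ev_mul, mul_left_comm]
      exact mul_nonneg (hlT x hx) (mul_self_nonneg _)) h1
    simpa [hl0] using h2
  have hdir : ∀ t : Pt, ddir t u = 0 := by
    intro t
    have ht : t ∈ Submodule.span ℝ {t : Pt | ∃ a ∈ T.erase b, t = a - b} := by
      rw [span_edges hT hcard hb]; trivial
    induction ht using Submodule.span_induction with
    | mem t ht =>
      obtain ⟨a, ha, rfl⟩ := ht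
      exact hedge a ha
    | zero => simp [ddir]
    | add s t _ _ hs ht =>
      have : ddir (s + t) u = ddir s u + ddir t u := by
        simp [ddir, add_smul, Finset.sum_add_distrib]
      rw [this, hs, ht, add_zero]
    | smul r t _ ht =>
      have : ddir (r • t) u = r • ddir t u := by
        simp [ddir, Finset.smul_sum, smul_smul]
      rw [this, ht, smul_zero]
  refine ⟨fun j => by rw [← ddir_single, hdir], fun a ha x hx => ?_⟩
  by_cases hab : a = b
  · subst hab; exact hub x hx
  have ha' : a ∈ T.erase b := Finset.mem_erase.2 ⟨hab, ha⟩
  have hb' : b ∈ T.erase a := Finset.mem_erase.2 ⟨Ne.symm hab, hb⟩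
  -- With the derivative gone, testing with `u - g a` leaves its squared norm on the face.
  have h1 := hface a ha' (u - g a) (Submodule.sub_mem _ hu (hg a ha))
  rw [hedge a ha', zero_mul, map_zero] at h1
  obtain ⟨-, d, hd, h⟩ := normal_spec hT hcard ha
  rw [← neg_sub b a, inner_neg_right, h b hb', eq_comm, mul_eq_zero,
    or_iff_right (neg_ne_zero.2 hd.ne')] at h1
  have h2 := eq_zero_of_face_integral_eq_zero hT hcard ha
    ((continuous_ev (u - g a)).mul (continuous_ev (u - g a))) (fun x => mul_self_nonneg _) h1 x hx
  rw [Pi.mul_apply, mul_self_eq_zero, ev_sub, sub_eq_zero] at h2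
  exact h2

end Tetrahedron

/-! ### A solvability criterion -/

/-- A square system whose left kernel is contained in its right kernel is solvable for all right-hand
sides that vanish on the kernel. -/
theorem exists_forall_eq {E : Type*} [AddCommGroup E] [Module ℝ E] [FiniteDimensional ℝ E]
    (B : E →ₗ[ℝ] E →ₗ[ℝ] ℝ) (hker : ∀ x, (∀ y, B x y = 0) → ∀ y, B y x = 0)
    (ℓ : E →ₗ[ℝ] ℝ) (hℓ : ∀ x, (∀ y, B x y = 0) → ℓ x = 0) : ∃ x, ∀ y, B x y = ℓ y := by
  -- On a complement of the kernel the form is injective, hence surjective by dimension; the kernel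
  -- part of a test vector contributes nothing to either side.
  obtain ⟨C, hC⟩ := (LinearMap.ker B).exists_isCompl
  have hK : ∀ z ∈ LinearMap.ker B, ∀ y, B z y = 0 := fun z hz y => by
    rw [LinearMap.mem_ker.1 hz]; rfl
  have hsplit : ∀ y : E, ∃ z ∈ LinearMap.ker B, ∃ c ∈ C, z + c = y := fun y =>
    Submodule.mem_sup.1 (hC.sup_eq_top ▸ Submodule.mem_top : y ∈ LinearMap.ker B ⊔ C)
  let A : C →ₗ[ℝ] Module.Dual ℝ C := B.domRestrict₁₂ C C
  have hA : Function.Injective A := by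
    rw [← LinearMap.ker_eq_bot, LinearMap.ker_eq_bot']
    intro x hx
    have h1 : ∀ y, B x y = 0 := by
      intro y
      obtain ⟨z, hz, c, hc, rfl⟩ := hsplit y
      rw [map_add, hker z (hK z hz) x, zero_add]
      exact LinearMap.congr_fun hx ⟨c, hc⟩
    have h2 : (x : E) ∈ LinearMap.ker B ⊓ C := ⟨LinearMap.mem_ker.2 (LinearMap.ext h1), x.2⟩
    rw [hC.inf_eq_bot] at h2
    exact Subtype.ext h2
  have hsurj : Function.Surjective A :=
    (LinearMap.injective_iff_surjective_of_finrank_eq_finrank Subspace.dual_finrank_eq.symm).1 hA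
  obtain ⟨x, hx⟩ := hsurj (ℓ.comp C.subtype)
  refine ⟨x, fun y => ?_⟩
  obtain ⟨z, hz, c, hc, rfl⟩ := hsplit y
  rw [map_add, map_add, hker z (hK z hz) x, hℓ z (hK z hz)]
  exact congrArg (0 + ·) (LinearMap.congr_fun hx ⟨c, hc⟩)

/-! ### Lifting face traces orthogonally to lower degrees. -/

section Tetrahedron

variable {T : Finset Pt} (hT : AffineIndependent ℝ ((↑) : T → Pt)) (hcard : T.card = 4)
include hT hcard

/-- Every trace on a face is the trace of a polynomial that is orthogonal to all polynomials of lower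
degree. -/
theorem exists_orthogonal_lift {k : ℕ} {b : Pt} (hb : b ∈ T) {g : Poly} (hg : g ∈ P k) :
    ∃ w ∈ P k, (∀ x ∈ hull (T.erase b), ev w x = ev g x) ∧
      ∀ s : Poly, s.totalDegree < k → cellInt T (w * s) = 0 := by
  cases k with
  | zero => exact ⟨g, hg, fun _ _ => rfl, fun s hs => absurd hs (Nat.not_lt_zero _)⟩
  | succ m =>
    obtain ⟨l, hl, hl0, hlF, hlT⟩ := exists_face_poly hT hcard hb
    -- The lift is sought as `g - l r`, which has the right trace since `l` vanishes on the face.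
    -- Orthogonality is a linear system for `r ∈ P m`, definite because its form is the `L²` product
    -- with weight `l ≥ 0`.
    let B : P m →ₗ[ℝ] P m →ₗ[ℝ] ℝ :=
      (((LinearMap.mul ℝ Poly).compr₂ (cellInt T)).compl₁₂ (LinearMap.mulLeft ℝ l)
        LinearMap.id).domRestrict₁₂ (P m) (P m)
    have hB : ∀ r s : P m, B r s = cellInt T (l * r * s) := fun _ _ => rfl
    have hker : ∀ x, (∀ y, B x y = 0) → x = 0 := by
      intro x hx
      have h1 := hx x
      rw [hB, cellInt_apply] at h1
      have h2 := eq_zero_of_integral_ev_eq_zero hT hcard (fun y hy => by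
        rw [ev_mul, ev_mul, mul_assoc]
        exact mul_nonneg (hlT y hy) (mul_self_nonneg _)) h1
      simpa [hl0] using h2
    let ℓ : P m →ₗ[ℝ] ℝ := (cellInt T).comp ((LinearMap.mulLeft ℝ g).comp (P m).subtype)
    obtain ⟨r, hr⟩ := exists_forall_eq B (fun x hx y => by rw [hker x hx, map_zero]) ℓ
      (fun x hx => by rw [hker x hx, map_zero])
    refine ⟨g - l * r, Submodule.sub_mem _ hg ?_, fun x hx => ?_, fun s hs => ?_⟩
    · have := mul_mem_P hl r.2
      rwa [add_comm] at this
    · rw [ev_sub, ev_mul, hlF x hx, zero_mul, sub_zero]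
    · have h1 : cellInt T (l * r * s) = cellInt T (g * s) :=
        hr ⟨s, mem_P.2 (Nat.lt_succ_iff.1 hs)⟩
      rw [sub_mul, map_sub, h1, sub_self]

end Tetrahedron

theorem cellInner_ev {ι : Type} [Fintype ι] (T : Finset Pt) (a b : ι → Poly) :
    cellInner T (fun i => ev (a i)) (fun i => ev (b i)) = ∑ i, cellInt T (a i * b i) := by
  rw [← map_sum, cellInt_apply, cellInner]
  simp only [ev_sum, ev_mul]

/-! ### The scheme as one bilinear form on polynomial data. -/

namespace Mesh

variable {Ω : Set Pt} (M : Mesh Ω)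

/-- Skeleton functions given by polynomials. -/
abbrev PolySkel : Type := M.facets → Fin 3 → Poly

/-- Polynomial vector functions on the faces of each cell. -/
abbrev PolyTrace : Type := M.cells → M.facets → Fin 3 → Poly

/-- The unknowns of one step, with the skeleton unknown represented by polynomials. -/
abbrev State : Type := M.MatField × M.VecField × M.ScalField × M.PolySkel

/-- The skeleton function defined by polynomials. -/
noncomputable def skelFun (g : M.PolySkel) : M.SkelField := fun F x i => ev (g F i) x

variable {M}

theorem integrableOn_facet (F : M.facets) {g : Pt → ℝ} (hg : Continuous g) :
    IntegrableOn g (hull F) μHE[2] := by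
  obtain ⟨T, hT⟩ := exists_cell F
  obtain ⟨a, ha, hF⟩ := exists_vertex hT
  rw [hF]
  exact integrableOn_face (M.indep_cell T) (M.card_cell T) ha hg

theorem eq_zero_of_facet_integral_eq_zero (F : M.facets) {g : Pt → ℝ} (hg : Continuous g)
    (h0 : ∀ x, 0 ≤ g x) (hint : ∫ x in hull F, g x ∂μHE[2] = 0) : ∀ x ∈ hull F, g x = 0 := by
  obtain ⟨T, hT⟩ := exists_cell F
  obtain ⟨a, ha, hF⟩ := exists_vertex hT
  rw [hF] at hint ⊢
  exact eq_zero_of_face_integral_eq_zero (M.indep_cell T) (M.card_cell T) ha hg h0 hint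

/-- The integral of a polynomial over a face. -/
noncomputable def faceInt (F : M.facets) : Poly →ₗ[ℝ] ℝ where
  toFun q := ∫ x in hull F, ev q x ∂μHE[2]
  map_add' p q := by
    simp only [ev_add]
    exact integral_add (integrableOn_facet F (continuous_ev p)) (integrableOn_facet F (continuous_ev q))
  map_smul' c q := by
    simp only [ev_smul, RingHom.id_apply, smul_eq_mul]
    exact integral_const_mul _ _

theorem faceInt_apply (F : M.facets) (q : Poly) : faceInt F q = ∫ x in hull F, ev q x ∂μHE[2] := rfl

theorem eq_zero_of_faceInt_sq (F : M.facets) {q : Poly} (h : faceInt F (q * q) = 0) :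
    ∀ x ∈ hull F, ev q x = 0 := fun x hx => by
  have := eq_zero_of_facet_integral_eq_zero F (continuous_ev (q * q))
    (fun x => by rw [ev_mul]; exact mul_self_nonneg _) h x hx
  rwa [ev_mul, mul_self_eq_zero] at this

theorem faceInt_congr (F : M.facets) {p q : Poly} (h : ∀ x ∈ hull F, ev p x = ev q x) :
    faceInt F p = faceInt F q :=
  setIntegral_congr_fun (measurableSet_hull _) h

variable (M)

/-- `(L, G)` as a bilinear form. -/
noncomputable def formW : M.MatField →ₗ[ℝ] M.MatField →ₗ[ℝ] ℝ :=
  LinearMap.mk₂ ℝ (fun L G => ∑ T : M.cells, ∑ ij : Fin 3 × Fin 3,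
      cellInt T (L T ij.1 ij.2 * G T ij.1 ij.2))
    (by simp [add_mul, Finset.sum_add_distrib]) (by simp [Finset.mul_sum])
    (by simp [mul_add, Finset.sum_add_distrib]) (by simp [Finset.mul_sum])

/-- `(u, v)` as a bilinear form. -/
noncomputable def formV : M.VecField →ₗ[ℝ] M.VecField →ₗ[ℝ] ℝ :=
  LinearMap.mk₂ ℝ (fun u v => ∑ T : M.cells, ∑ i, cellInt T (u T i * v T i))
    (by simp [add_mul, Finset.sum_add_distrib]) (by simp [Finset.mul_sum])
    (by simp [mul_add, Finset.sum_add_distrib]) (by simp [Finset.mul_sum])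

/-- `(p, q)` as a bilinear form. -/
noncomputable def formQ : M.ScalField →ₗ[ℝ] M.ScalField →ₗ[ℝ] ℝ :=
  LinearMap.mk₂ ℝ (fun p q => ∑ T : M.cells, cellInt T (p T * q T))
    (by simp [add_mul, Finset.sum_add_distrib]) (by simp [Finset.mul_sum])
    (by simp [mul_add, Finset.sum_add_distrib]) (by simp [Finset.mul_sum])

/-- `⟪a, b⟫` as a bilinear form. -/
noncomputable def formT : M.PolyTrace →ₗ[ℝ] M.PolyTrace →ₗ[ℝ] ℝ :=
  LinearMap.mk₂ ℝ (fun a b => ∑ T : M.cells, ∑ F ∈ M.facetsOf T, ∑ i, faceInt F (a T F i * b T F i))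
    (by simp [add_mul, Finset.sum_add_distrib]) (by simp [Finset.mul_sum])
    (by simp [mul_add, Finset.sum_add_distrib]) (by simp [Finset.mul_sum])

theorem innerW_eq (L G : M.MatField) : M.innerW L G = M.formW L G :=
  Finset.sum_congr rfl fun T _ => cellInner_ev (T : Finset Pt)
    (fun ij : Fin 3 × Fin 3 => L T ij.1 ij.2) (fun ij => G T ij.1 ij.2)

theorem innerV_eq (u v : M.VecField) : M.innerV u v = M.formV u v :=
  Finset.sum_congr rfl fun T _ => cellInner_ev (T : Finset Pt) (u T) (v T)

theorem innerQ_eq (p q : M.ScalField) : M.innerQ p q = M.formQ p q :=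
  Finset.sum_congr rfl fun T _ =>
    (cellInner_ev (T : Finset Pt) (fun _ : Unit => p T) (fun _ => q T)).trans (by simp)

/-- Only values on the closed triangles matter, so skeleton functions may be replaced by any
polynomial representatives. -/
theorem bdInner_eq {a b : M.cells → M.facets → Pt → Fin 3 → ℝ} {c d : M.PolyTrace}
    (ha : ∀ T F, ∀ x ∈ hull F.1, ∀ i, a T F x i = ev (c T F i) x)
    (hb : ∀ T F, ∀ x ∈ hull F.1, ∀ i, b T F x i = ev (d T F i) x) :
    M.bdInner a b = M.formT c d := by
  refine Finset.sum_congr rfl fun T _ => Finset.sum_congr rfl fun F _ => ?_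
  rw [← map_sum, faceInt_apply]
  refine setIntegral_congr_fun (measurableSet_hull _) fun x hx => ?_
  simp only [ev_sum, ev_mul, ha T F x hx, hb T F x hx]

/-- The divergence as a linear map. -/
noncomputable def divL : M.MatField →ₗ[ℝ] M.VecField where
  toFun := M.divW
  map_add' G H := by ext1 T; ext1 i; simp [divW, Finset.sum_add_distrib]
  map_smul' c G := by ext1 T; ext1 i; simp [divW, Finset.smul_sum]

/-- The gradient as a linear map. -/
noncomputable def gradL : M.ScalField →ₗ[ℝ] M.VecField where
  toFun := M.gradQ
  map_add' p q := by ext1 T; ext1 i; simp [gradQ]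
  map_smul' c p := by ext1 T; ext1 i; simp [gradQ]

/-- Skeleton functions on the boundaries of the cells. -/
noncomputable def skelL : M.PolySkel →ₗ[ℝ] M.PolyTrace where
  toFun g _ F i := g F i
  map_add' _ _ := rfl
  map_smul' _ _ := rfl

/-- The trace of a vector field. -/
noncomputable def trVL : M.VecField →ₗ[ℝ] M.PolyTrace where
  toFun v T _ i := v T i
  map_add' _ _ := rfl
  map_smul' _ _ := rfl

/-- The normal trace of a matrix field. -/
noncomputable def trWL : M.MatField →ₗ[ℝ] M.PolyTrace where
  toFun G T F i := ∑ j, normal T F j • G T i j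
  map_add' G H := by ext1 T; ext1 F; ext1 i; simp [Finset.sum_add_distrib]
  map_smul' c G := by ext1 T; ext1 F; ext1 i; simp [Finset.smul_sum, smul_comm c]

/-- The trace of a scalar field, multiplied by the normal. -/
noncomputable def trQL : M.ScalField →ₗ[ℝ] M.PolyTrace where
  toFun q T F i := normal T F i • q T
  map_add' p q := by ext1 T; ext1 F; ext1 i; simp
  map_smul' c q := by ext1 T; ext1 F; ext1 i; simp [smul_comm c]

variable {M}

open Classical in
/-- The stabilization as a linear map. -/
noncomputable def stabL (star : M.StarChoice) (τ : ℝ) : M.VecField × M.PolySkel →ₗ[ℝ] M.PolyTrace where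
  toFun x T F i := (if F = star.face T then τ else 0) • (x.1 T i - x.2 F i)
  map_add' x y := by
    ext1 T; ext1 F; ext1 i
    simp only [Prod.fst_add, Prod.snd_add, Pi.add_apply, ← smul_add]
    congr 1; abel
  map_smul' c x := by
    ext1 T; ext1 F; ext1 i
    simp only [Prod.smul_fst, Prod.smul_snd, Pi.smul_apply, RingHom.id_apply, ← smul_sub,
      smul_comm c]

/-- The bilinear form of one step of the scheme. -/
noncomputable def stepForm (star : M.StarChoice) (τ c : ℝ) : M.State →ₗ[ℝ] M.State →ₗ[ℝ] ℝ :=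
  LinearMap.mk₂ ℝ (fun x y =>
      (M.formW x.1 y.1 + M.formV x.2.1 (M.divL y.1) - M.formT (M.skelL x.2.2.2) (M.trWL y.1)) +
      (M.formV (-M.divL x.1 + M.gradL x.2.2.1) y.2.1 +
        M.formT (stabL star τ (x.2.1, x.2.2.2)) (M.trVL y.2.1)) +
      (c * M.formQ x.2.2.1 y.2.2.1 - M.formV x.2.1 (M.gradL y.2.2.1) +
        M.formT (M.skelL x.2.2.2) (M.trQL y.2.2.1)) -
      -- The flux equation is subtracted, so that testing with `x` itself cancels all coupling terms
      -- and completes the square `(u - λ)²`.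
      M.formT (-M.trWL x.1 + M.trQL x.2.2.1 + stabL star τ (x.2.1, x.2.2.2)) (M.skelL y.2.2.2))
    (fun x x' y => by
      have : stabL star τ ((x + x').2.1, (x + x').2.2.2) =
        stabL star τ (x.2.1, x.2.2.2) + stabL star τ (x'.2.1, x'.2.2.2) := by rw [← map_add]; rfl
      rw [this]
      simp only [Prod.fst_add, Prod.snd_add, map_add, LinearMap.add_apply, map_neg,
        LinearMap.neg_apply]
      ring)
    (fun r x y => by
      have : stabL star τ ((r • x).2.1, (r • x).2.2.2) = r • stabL star τ (x.2.1, x.2.2.2) := by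
        rw [← map_smul]; rfl
      rw [this]
      simp only [Prod.smul_fst, Prod.smul_snd, map_add, map_smul, LinearMap.add_apply, map_neg,
        LinearMap.neg_apply, LinearMap.smul_apply, smul_eq_mul]
      ring)
    (fun x y y' => by
      simp only [Prod.fst_add, Prod.snd_add, map_add, LinearMap.add_apply, map_neg,
        LinearMap.neg_apply]
      ring)
    (fun r x y => by
      simp only [Prod.smul_fst, Prod.smul_snd, map_add, map_smul, LinearMap.add_apply, map_neg,
        LinearMap.neg_apply, smul_eq_mul]
      ring)

theorem stepForm_apply (star : M.StarChoice) (τ c : ℝ) (x y : M.State) :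
    stepForm star τ c x y =
      (M.formW x.1 y.1 + M.formV x.2.1 (M.divL y.1) - M.formT (M.skelL x.2.2.2) (M.trWL y.1)) +
      (M.formV (-M.divL x.1 + M.gradL x.2.2.1) y.2.1 +
        M.formT (stabL star τ (x.2.1, x.2.2.2)) (M.trVL y.2.1)) +
      (c * M.formQ x.2.2.1 y.2.2.1 - M.formV x.2.1 (M.gradL y.2.2.1) +
        M.formT (M.skelL x.2.2.2) (M.trQL y.2.2.1)) -
      M.formT (-M.trWL x.1 + M.trQL x.2.2.1 + stabL star τ (x.2.1, x.2.2.2)) (M.skelL y.2.2.2) :=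
  rfl

variable (M) in
/-- The polynomial representatives of skeleton functions. -/
def skelSpace (k : ℕ) : Submodule ℝ M.PolySkel where
  carrier := {g | ∀ F i, g F i ∈ P k ∧ (M.IsBoundary F → g F i = 0)}
  add_mem' hg hh F i := ⟨Submodule.add_mem _ (hg F i).1 (hh F i).1, fun hF => by
    rw [Pi.add_apply, Pi.add_apply, (hg F i).2 hF, (hh F i).2 hF, add_zero]⟩
  zero_mem' _ _ := ⟨Submodule.zero_mem _, fun _ => rfl⟩
  smul_mem' c g hg F i := ⟨Submodule.smul_mem _ _ (hg F i).1, fun hF => by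
    rw [Pi.smul_apply, Pi.smul_apply, (hg F i).2 hF, smul_zero]⟩

variable (M) in
/-- The discrete space of one step. -/
def stateSpace (k : ℕ) : Submodule ℝ M.State where
  carrier := {x | x.1 ∈ M.W k ∧ x.2.1 ∈ M.V k ∧ x.2.2.1 ∈ M.Q k ∧ x.2.2.2 ∈ M.skelSpace k}
  add_mem' hx hy := ⟨fun T i j => Submodule.add_mem _ (hx.1 T i j) (hy.1 T i j),
    fun T i => Submodule.add_mem _ (hx.2.1 T i) (hy.2.1 T i),
    fun T => Submodule.add_mem _ (hx.2.2.1 T) (hy.2.2.1 T),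
    Submodule.add_mem _ hx.2.2.2 hy.2.2.2⟩
  zero_mem' := ⟨fun _ _ _ => Submodule.zero_mem _, fun _ _ => Submodule.zero_mem _,
    fun _ => Submodule.zero_mem _, Submodule.zero_mem _⟩
  smul_mem' _ _ hx := ⟨fun T i j => Submodule.smul_mem _ _ (hx.1 T i j),
    fun T i => Submodule.smul_mem _ _ (hx.2.1 T i),
    fun T => Submodule.smul_mem _ _ (hx.2.2.1 T),
    Submodule.smul_mem _ _ hx.2.2.2⟩

instance finiteDimensional_stateSpace (k : ℕ) : FiniteDimensional ℝ (M.stateSpace k) := by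
  let ι : ((M.cells → Fin 3 → Fin 3 → P k) × (M.cells → Fin 3 → P k) × (M.cells → P k) ×
      (M.facets → Fin 3 → P k)) →ₗ[ℝ] M.State :=
    { toFun := fun x => (fun T i j => x.1 T i j, fun T i => x.2.1 T i, fun T => x.2.2.1 T,
        fun F i => x.2.2.2 F i)
      map_add' := fun _ _ => rfl
      map_smul' := fun _ _ => rfl }
  refine Submodule.finiteDimensional_of_le (S₂ := LinearMap.range ι) fun x hx => ?_
  exact ⟨(fun T i j => ⟨_, hx.1 T i j⟩, fun T i => ⟨_, hx.2.1 T i⟩, fun T => ⟨_, hx.2.2.1 T⟩,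
    fun F i => ⟨_, (hx.2.2.2 F i).1⟩), rfl⟩

/-- Every admissible skeleton function is represented by polynomials. -/
theorem exists_rep {k : ℕ} {lam : M.SkelField} (h : lam ∈ M.Tr k) :
    ∃ g ∈ M.skelSpace k, ∀ F, ∀ x ∈ hull F.1, ∀ i, lam F x i = ev (g F i) x := by
  have : ∀ F : M.facets, ∃ g : Fin 3 → Poly, (∀ i, g i ∈ P k ∧ (M.IsBoundary F → g i = 0)) ∧
      ∀ x ∈ hull F.1, ∀ i, lam F x i = ev (g i) x := by
    intro F
    by_cases hF : M.IsBoundary F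
    · refine ⟨0, fun i => ⟨Submodule.zero_mem _, fun _ => rfl⟩, fun x hx i => ?_⟩
      rw [(h F).2 hF x hx, Pi.zero_apply, Pi.zero_apply, ev_zero]
    · obtain ⟨g, hg, hgx⟩ := (h F).1
      exact ⟨g, fun i => ⟨hg i, fun h => absurd h hF⟩, hgx⟩
  choose g hg hgx using this
  exact ⟨g, fun F i => hg F i, hgx⟩

theorem skelFun_mem {k : ℕ} {g : M.PolySkel} (h : g ∈ M.skelSpace k) : M.skelFun g ∈ M.Tr k :=
  fun F => ⟨⟨g F, fun i => (h F i).1, fun _ _ _ => rfl⟩, fun hF x _ => funext fun i => by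
    rw [skelFun, (h F i).2 hF, ev_zero, Pi.zero_apply]⟩

theorem trW_eq (G : M.MatField) (T : M.cells) (F : M.facets) (x : Pt) (i : Fin 3) :
    M.trW G T F x i = ev (M.trWL G T F i) x := by
  simp [trW, trWL, ev_sum, ev_smul, mul_comm]

theorem trQ_eq (q : M.ScalField) (T : M.cells) (F : M.facets) (x : Pt) (i : Fin 3) :
    M.trQ q T F x i = ev (M.trQL q T F i) x := by
  simp [trQ, trQL, ev_smul, mul_comm]

theorem stab_eq (star : M.StarChoice) (τ : ℝ) (u : M.VecField) {lam : M.SkelField} {g : M.PolySkel}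
    {F : M.facets} {x : Pt} {i : Fin 3} (h : lam F x i = ev (g F i) x) (T : M.cells) :
    stab star τ u lam T F x i = ev (stabL star τ (u, g) T F i) x := by
  simp only [stab, stabL, LinearMap.coe_mk, AddHom.coe_mk, ev_smul, ev_sub, h]

/-- The scheme in terms of the bilinear form. -/
theorem solvesStep_iff {star : M.StarChoice} {k : ℕ} {τ dt : ℝ} {f : Pt → Pt} {pOld : M.ScalField}
    {L : M.MatField} {u : M.VecField} {p : M.ScalField} {lam : M.SkelField} {g : M.PolySkel}
    (hlam : lam ∈ M.Tr k) (hg : g ∈ M.skelSpace k)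
    (hrep : ∀ F, ∀ x ∈ hull F.1, ∀ i, lam F x i = ev (g F i) x) :
    SolvesStep star k τ dt f pOld L u p lam ↔ (L, u, p, g) ∈ M.stateSpace k ∧
      ∀ y ∈ M.stateSpace k, stepForm star τ (1 / dt) (L, u, p, g) y =
        M.load f y.2.1 + 1 / dt * M.formQ pOld y.2.2.1 := by
  have e1 : ∀ G, M.bdInner (M.ofSkel lam) (M.trW G) = M.formT (M.skelL g) (M.trWL G) := fun G =>
    M.bdInner_eq (fun T F x hx i => hrep F x hx i) (fun T F x _ i => trW_eq G T F x i)
  have e2 : ∀ v, M.bdInner (stab star τ u lam) (M.trV v) = M.formT (stabL star τ (u, g)) (M.trVL v) :=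
    fun v => M.bdInner_eq (fun T F x hx i => stab_eq star τ u (hrep F x hx i) T) (fun T F x _ i => rfl)
  have e3 : ∀ q, M.bdInner (M.ofSkel lam) (M.trQ q) = M.formT (M.skelL g) (M.trQL q) := fun q =>
    M.bdInner_eq (fun T F x hx i => hrep F x hx i) (fun T F x _ i => trQ_eq q T F x i)
  have e4 : ∀ mu m, (∀ F, ∀ x ∈ hull F.1, ∀ i, mu F x i = ev (m F i) x) →
      M.bdInner (-M.trW L + M.trQ p + stab star τ u lam) (M.ofSkel mu) =
      M.formT (-M.trWL L + M.trQL p + stabL star τ (u, g)) (M.skelL m) := fun mu m hm =>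
    M.bdInner_eq (fun T F x hx i => by
      simp only [Pi.add_apply, Pi.neg_apply, ev_add, ev_neg, trW_eq, trQ_eq,
        stab_eq star τ u (hrep F x hx i)]) (fun T F x hx i => hm F x hx i)
  constructor
  · intro h
    refine ⟨⟨h.L_mem, h.u_mem, h.p_mem, hg⟩, fun y hy => ?_⟩
    have h1 := h.eq_gradient y.1 hy.1
    have h2 := h.eq_momentum y.2.1 hy.2.1
    have h3 := h.eq_pressure y.2.2.1 hy.2.2.1
    have h4 := h.eq_flux (M.skelFun y.2.2.2) (skelFun_mem hy.2.2.2)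
    rw [e1, innerW_eq, innerV_eq] at h1
    rw [e2, innerV_eq] at h2
    rw [e3, innerQ_eq, innerV_eq, innerQ_eq] at h3
    rw [e4 (M.skelFun y.2.2.2) y.2.2.2 (fun _ _ _ _ => rfl)] at h4
    rw [stepForm_apply]
    change (_ + M.formV u (M.divW y.1) - _) + (M.formV (-M.divW L + M.gradQ p) _ + _) +
      (_ - M.formV u (M.gradQ y.2.2.1) + _) - _ = _
    linear_combination h1 + h2 + h3 - h4
  · rintro ⟨hx, h⟩
    have hl0 : M.load f 0 = 0 := by simp [load, cellInner, ev_zero]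
    refine ⟨hx.1, hx.2.1, hx.2.2.1, hlam, fun G hG => ?_, fun v hv => ?_, fun q hq => ?_,
      fun mu hmu => ?_⟩
    · have := h (G, 0, 0, 0) ⟨hG, fun _ _ => Submodule.zero_mem _, fun _ => Submodule.zero_mem _,
        Submodule.zero_mem _⟩
      simp only [stepForm_apply, map_zero, hl0, mul_zero, add_zero, sub_zero] at this
      rw [e1, innerW_eq, innerV_eq]
      exact this
    · have := h (0, v, 0, 0) ⟨fun _ _ _ => Submodule.zero_mem _, hv, fun _ => Submodule.zero_mem _,
        Submodule.zero_mem _⟩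
      simp only [stepForm_apply, map_zero, mul_zero, add_zero, sub_zero, zero_add] at this
      rw [e2, innerV_eq]
      exact this
    · have := h (0, 0, q, 0) ⟨fun _ _ _ => Submodule.zero_mem _, fun _ _ => Submodule.zero_mem _, hq,
        Submodule.zero_mem _⟩
      simp only [stepForm_apply, map_zero, hl0, add_zero, sub_zero, zero_add] at this
      rw [e3, innerQ_eq, innerV_eq, innerQ_eq]
      exact this
    · obtain ⟨m, hm, hmx⟩ := exists_rep hmu
      have := h (0, 0, 0, m) ⟨fun _ _ _ => Submodule.zero_mem _, fun _ _ => Submodule.zero_mem _,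
        fun _ => Submodule.zero_mem _, hm⟩
      simp only [stepForm_apply, map_zero, hl0, mul_zero, add_zero, sub_zero, zero_sub,
        neg_eq_zero] at this
      rw [e4 mu m hmx]
      exact this

end Mesh

/-! ### Energy identity and uniqueness of a step. -/

theorem cellInt_sq_nonneg (T : Finset Pt) (q : Poly) : 0 ≤ cellInt T (q * q) :=
  integral_nonneg fun x => by rw [ev_mul]; exact mul_self_nonneg _

namespace Mesh

variable {Ω : Set Pt} {M : Mesh Ω}

theorem faceInt_sq_nonneg (F : M.facets) (q : Poly) : 0 ≤ faceInt F (q * q) :=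
  integral_nonneg fun x => by rw [ev_mul]; exact mul_self_nonneg _

theorem eq_zero_of_cellInt_sq {T : M.cells} {q : Poly} (h : cellInt T (q * q) = 0) : q = 0 :=
  StokesHDG.eq_zero_of_cellInt_sq (M.indep_cell T) (M.card_cell T) h

theorem formW_apply (L G : M.MatField) : M.formW L G =
    ∑ T : M.cells, ∑ ij : Fin 3 × Fin 3, cellInt T (L T ij.1 ij.2 * G T ij.1 ij.2) := rfl

theorem formV_apply (u v : M.VecField) :
    M.formV u v = ∑ T : M.cells, ∑ i, cellInt T (u T i * v T i) := rfl

theorem formQ_apply (p q : M.ScalField) : M.formQ p q = ∑ T : M.cells, cellInt T (p T * q T) := rfl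

theorem formT_apply (a b : M.PolyTrace) : M.formT a b =
    ∑ T : M.cells, ∑ F ∈ M.facetsOf T, ∑ i, faceInt F (a T F i * b T F i) := rfl

theorem formV_comm (u v : M.VecField) : M.formV u v = M.formV v u := by
  simp only [formV_apply, mul_comm]

theorem formT_comm (a b : M.PolyTrace) : M.formT a b = M.formT b a := by
  simp only [formT_apply, mul_comm]

theorem formT_congr {a b c : M.PolyTrace}
    (h : ∀ T F, ∀ x ∈ hull F.1, ∀ i, ev (a T F i) x = ev (b T F i) x) :
    M.formT a c = M.formT b c := by
  simp only [formT_apply]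
  refine Finset.sum_congr rfl fun T _ => Finset.sum_congr rfl fun F _ => Finset.sum_congr rfl
    fun i _ => faceInt_congr F fun x hx => ?_
  rw [ev_mul, ev_mul, h T F x hx]

theorem eq_zero_of_formW {L : M.MatField} (h : M.formW L L = 0) : L = 0 := by
  rw [formW_apply, Finset.sum_eq_zero_iff_of_nonneg
    (fun T _ => Finset.sum_nonneg fun ij _ => cellInt_sq_nonneg _ _)] at h
  ext1 T; ext1 i; ext1 j
  have := h T (Finset.mem_univ _)
  rw [Finset.sum_eq_zero_iff_of_nonneg (fun ij _ => cellInt_sq_nonneg _ _)] at this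
  exact eq_zero_of_cellInt_sq (this (i, j) (Finset.mem_univ _))

theorem eq_zero_of_formQ {p : M.ScalField} (h : M.formQ p p = 0) : p = 0 := by
  rw [formQ_apply, Finset.sum_eq_zero_iff_of_nonneg (fun T _ => cellInt_sq_nonneg _ _)] at h
  ext1 T
  exact eq_zero_of_cellInt_sq (h T (Finset.mem_univ _))

theorem formT_stabL (star : M.StarChoice) (τ : ℝ) (x : M.VecField × M.PolySkel) (b : M.PolyTrace) :
    M.formT (stabL star τ x) b = ∑ T : M.cells, τ * ∑ i,
      faceInt (star.face T) ((x.1 T i - x.2 (star.face T) i) * b T (star.face T) i) := by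
  rw [formT_apply]
  refine Finset.sum_congr rfl fun T _ => ?_
  rw [Finset.sum_eq_single (star.face T)]
  · rw [Finset.mul_sum]
    refine Finset.sum_congr rfl fun i _ => ?_
    simp [stabL]
  · intro F _ hF
    simp [stabL, hF]
  · exact fun h => absurd (star.mem T) h

/-- The terms coupling different unknowns cancel algebraically in pairs, without integration by
parts; only the stabilization tested with `u - λ` is left beside the two squares. -/
theorem stepForm_self (star : M.StarChoice) (τ c : ℝ) (x : M.State) :
    stepForm star τ c x x = M.formW x.1 x.1 + c * M.formQ x.2.2.1 x.2.2.1 +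
      ∑ T : M.cells, τ * ∑ i, faceInt (star.face T)
        ((x.2.1 T i - x.2.2.2 (star.face T) i) * (x.2.1 T i - x.2.2.2 (star.face T) i)) := by
  have h : M.formT (stabL star τ (x.2.1, x.2.2.2)) (M.trVL x.2.1 - M.skelL x.2.2.2) =
      ∑ T : M.cells, τ * ∑ i, faceInt (star.face T)
        ((x.2.1 T i - x.2.2.2 (star.face T) i) * (x.2.1 T i - x.2.2.2 (star.face T) i)) :=
    formT_stabL star τ _ _
  rw [← h, stepForm_apply]
  simp only [map_add, map_sub, map_neg, LinearMap.add_apply, LinearMap.neg_apply]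
  rw [formV_comm x.2.1 (M.divL x.1), formV_comm x.2.1 (M.gradL x.2.2.1),
    formT_comm (M.skelL x.2.2.2), formT_comm (M.skelL x.2.2.2)]
  ring

theorem sum_facetsOf' (T : M.cells) (ψ : M.facets → ℝ) :
    ∑ F ∈ M.facetsOf T, ψ F = ∑ a ∈ T.1,
      if h : T.1.erase a ∈ M.facets then ψ ⟨T.1.erase a, h⟩ else 0 := by
  classical
  rw [← sum_facetsOf T fun S => if h : S ∈ M.facets then ψ ⟨S, h⟩ else 0]
  exact Finset.sum_congr rfl fun F _ => by rw [dif_pos F.2]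

theorem erase_mem_facets (T : M.cells) {a : Pt} (ha : a ∈ T.1) : T.1.erase a ∈ M.facets := by
  obtain ⟨F, -, hF⟩ := exists_facet T ha
  exact hF ▸ F.2

theorem cellInt_dd (T : M.cells) (j : Fin 3) (q : Poly) :
    cellInt T (dd j q) = ∑ F ∈ M.facetsOf T, normal T F j * faceInt F q := by
  have h := sum_facetsOf T fun S => normal T S j * ∫ y in hull S, ev q y ∂μHE[2]
  simp only [faceInt_apply]
  rw [h, ← ddir_single j q, cellInt_apply]
  simp only [ev_ddir]
  rw [integral_derivative (M.indep_cell T) (M.card_cell T)]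
  refine Finset.sum_congr rfl fun a _ => ?_
  rw [EuclideanSpace.inner_single_right]
  simp

-- Test fields living on one cell and one row, in a constant direction `t`, localize the weak
-- gradient equation to the form needed by `dd_eq_zero_and_trace_eq`. This is its volume term.
open Classical in
theorem formV_divL_single (u : M.VecField) (T : M.cells) (i : Fin 3) (t : Pt) (q : Poly) :
    M.formV u (M.divL (Pi.single T (Pi.single i fun j => t j • q))) = cellInt T (u T i * ddir t q) := by
  have h : M.divL (Pi.single T (Pi.single i fun j => t j • q)) =
      Pi.single T (Pi.single i (ddir t q)) := by
    ext1 T'; ext1 i'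
    change ∑ j, dd j ((Pi.single T (Pi.single i fun j => t j • q) : M.MatField) T' i' j) = _
    by_cases hT : T' = T
    · subst hT
      by_cases hi : i' = i
      · subst hi
        simp [ddir]
      · simp [hi]
    · simp [hT]
  rw [h, formV_apply, Finset.sum_eq_single T, Finset.sum_eq_single i]
  · simp
  · intro i' _ hi; simp [hi]
  · simp
  · intro T' _ hT; simp [hT]
  · simp

open Classical in
theorem formT_trWL_single (g : M.PolySkel) (T : M.cells) (i : Fin 3) (t : Pt) (q : Poly) :
    M.formT (M.skelL g) (M.trWL (Pi.single T (Pi.single i fun j => t j • q))) =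
      ∑ F ∈ M.facetsOf T, inner ℝ (normal T F) t * faceInt F (g F i * q) := by
  have h : ∀ F, M.trWL (Pi.single T (Pi.single i fun j => t j • q)) T F i =
      (inner ℝ (normal T F) t : ℝ) • q := by
    intro F
    change ∑ j, normal T F j • ((Pi.single T (Pi.single i fun j => t j • q) : M.MatField) T i j) = _
    simp only [Pi.single_eq_same, smul_smul, ← Finset.sum_smul, PiLp.inner_apply]
    congr 1
    exact Finset.sum_congr rfl fun j _ => by simp [mul_comm]
  rw [formT_apply, Finset.sum_eq_single T]
  · refine Finset.sum_congr rfl fun F _ => ?_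
    rw [Finset.sum_eq_single i]
    · rw [h, mul_smul_comm, map_smul]; rfl
    · intro i' _ hi
      simp [trWL, hi]
    · simp
  · intro T' _ hT
    simp [trWL, hT]
  · simp

/-- The homogeneous problem has only the trivial solution. -/
theorem eq_zero_of_stepForm {star : M.StarChoice} {τ c : ℝ} (hτ : 0 < τ) (hc : 0 < c) {k : ℕ}
    {x : M.State} (hx : x ∈ M.stateSpace k) (h : ∀ y ∈ M.stateSpace k, stepForm star τ c x y = 0) :
    x.1 = 0 ∧ x.2.1 = 0 ∧ x.2.2.1 = 0 ∧ ∀ F, ∀ y ∈ hull F.1, ∀ i, ev (x.2.2.2 F i) y = 0 := by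
  classical
  obtain ⟨L, u, p, g⟩ := x
  have hself := h _ hx
  rw [stepForm_self] at hself
  dsimp only at hself ⊢
  have n1 : 0 ≤ M.formW L L := Finset.sum_nonneg fun T _ => Finset.sum_nonneg fun ij _ =>
    cellInt_sq_nonneg _ _
  have n2 : 0 ≤ M.formQ p p := Finset.sum_nonneg fun T _ => cellInt_sq_nonneg _ _
  have n3 : ∀ T ∈ (Finset.univ : Finset M.cells), 0 ≤ τ * ∑ i, faceInt (star.face T)
      ((u T i - g (star.face T) i) * (u T i - g (star.face T) i)) := fun T _ =>
    mul_nonneg hτ.le (Finset.sum_nonneg fun i _ => faceInt_sq_nonneg _ _)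
  have n4 := Finset.sum_nonneg n3
  have n5 := mul_nonneg hc.le n2
  have hL : L = 0 := eq_zero_of_formW (by linarith)
  have hp : p = 0 := eq_zero_of_formQ <|
    (mul_eq_zero.1 (show c * M.formQ p p = 0 by linarith)).resolve_left hc.ne'
  have hstar : ∀ T i, ∀ y ∈ hull (star.face T).1, ev (u T i) y = ev (g (star.face T) i) y := by
    intro T i y hy
    have h1 := (Finset.sum_eq_zero_iff_of_nonneg n3).1 (by linarith) T (Finset.mem_univ _)
    have h2 := (Finset.sum_eq_zero_iff_of_nonneg fun i _ => faceInt_sq_nonneg _ _).1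
      ((mul_eq_zero.1 h1).resolve_left hτ.ne') i (Finset.mem_univ _)
    have h3 := eq_zero_of_faceInt_sq _ h2 y hy
    rwa [ev_sub, sub_eq_zero] at h3
  have hlocal : ∀ T : M.cells, ∀ i, (∀ j, dd j (u T i) = 0) ∧
      ∀ F ∈ M.facetsOf T, ∀ y ∈ hull F.1, ev (u T i) y = ev (g F i) y := by
    intro T i
    obtain ⟨b, hb, hbF⟩ := exists_vertex (star.mem T)
    -- The skeleton unknown indexed by opposite vertices; for vertices of `T` the default `0` is
    -- never taken.
    let gv : Pt → Poly := fun a => if h : T.1.erase a ∈ M.facets then g ⟨_, h⟩ i else 0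
    have hgv : ∀ a (F : M.facets), F.1 = T.1.erase a → gv a = g F i := by
      intro a F hF
      have : T.1.erase a ∈ M.facets := hF ▸ F.2
      simp only [gv, dif_pos this]
      rw [show (⟨T.1.erase a, this⟩ : M.facets) = F from Subtype.ext hF.symm]
    have key := dd_eq_zero_and_trace_eq (M.indep_cell T) (M.card_cell T) hb (hx.2.1 T i) (g := gv)
      (fun a ha => by
        rw [hgv a ⟨_, erase_mem_facets T ha⟩ rfl]
        exact (hx.2.2.2 _ i).1) ?_ ?_
    · refine ⟨key.1, fun F hF y hy => ?_⟩
      obtain ⟨a, ha, haF⟩ := exists_vertex hF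
      rw [← hgv a F haF]
      exact key.2 a ha y (haF ▸ hy)
    · intro t q hq
      have h1 := h (Pi.single T (Pi.single i fun j => t j • q), 0, 0, 0)
        ⟨fun T' i' j => by
          by_cases hT : T' = T
          · subst hT
            by_cases hi : i' = i
            · subst hi
              simpa using Submodule.smul_mem _ _ hq
            · simp [hi]
          · simp [hT], fun _ _ => Submodule.zero_mem _,
          fun _ => Submodule.zero_mem _, Submodule.zero_mem _⟩
      simp only [stepForm_apply, map_zero, mul_zero, add_zero, sub_zero, hL, LinearMap.zero_apply,
        zero_add] at h1
      rw [formV_divL_single, formT_trWL_single, sub_eq_zero] at h1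
      rw [h1, sum_facetsOf']
      refine Finset.sum_congr rfl fun a ha => ?_
      have hf := erase_mem_facets T ha
      rw [dif_pos hf, faceInt_apply, hgv a ⟨_, hf⟩ rfl]
      simp only [ev_mul]
    · intro y hy
      rw [hgv b (star.face T) hbF]
      exact hstar T i y (by rw [hbF]; exact hy)
  have hu : u = 0 := by
    -- Since `u` is constant on each cell, `u² = ∂₀(x₀ u²)`, and the divergence theorem moves
    -- everything to the faces. There `u` equals the single-valued `g`, so interior faces cancel and
    -- boundary faces give zero.
    have hsum : ∀ i, ∑ T : M.cells, cellInt T (u T i * u T i) = 0 := by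
      intro i
      have h1 : ∀ T : M.cells, cellInt T (u T i * u T i) = ∑ F ∈ M.facetsOf T,
          normal T F 0 * faceInt F (MvPolynomial.X 0 * (g F i * g F i)) := by
        intro T
        have h2 : dd 0 (MvPolynomial.X 0 * (u T i * u T i)) = u T i * u T i := by
          rw [dd_mul, dd_mul, (hlocal T i).1 0, zero_mul, mul_zero, add_zero, mul_zero, add_zero, dd,
            MvPolynomial.pderiv_X_self, one_mul]
        rw [← h2, cellInt_dd]
        refine Finset.sum_congr rfl fun F hF => ?_
        congr 1
        refine faceInt_congr F fun y hy => ?_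
        simp only [ev_mul, (hlocal T i).2 F hF y hy]
      rw [Finset.sum_congr rfl fun T _ => h1 T,
        Finset.sum_comm' (t' := Finset.univ)
          (s' := fun F => Finset.univ.filter fun T : M.cells => F ∈ M.facetsOf T) (by simp)]
      refine Finset.sum_eq_zero fun F _ => ?_
      by_cases hF : M.IsBoundary F
      · have h3 : g F i = 0 := (hx.2.2.2 F i).2 hF
        simp [h3]
      · rw [← Finset.sum_mul]
        have h3 := congrArg (fun v : Pt => v 0) (sum_normal_eq_zero hF)
        have h4 : ∑ T : M.cells with F ∈ M.facetsOf T, normal T F 0 = 0 := by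
          simpa using h3
        rw [h4, zero_mul]
    ext1 T; ext1 i
    exact eq_zero_of_cellInt_sq ((Finset.sum_eq_zero_iff_of_nonneg
      fun T _ => cellInt_sq_nonneg _ _).1 (hsum i) T (Finset.mem_univ _))
  refine ⟨hL, hu, hp, fun F y hy i => ?_⟩
  obtain ⟨T, hT⟩ := exists_cell F
  rw [← (hlocal T i).2 F hT y hy, hu, Pi.zero_apply, Pi.zero_apply, ev_zero]

/-- Solutions of one step are unique; the skeleton unknown is unique on the faces. -/
theorem SolvesStep.unique {star : M.StarChoice} {k : ℕ} {τ dt : ℝ} (hτ : 0 < τ) (hdt : 0 < dt)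
    {f : Pt → Pt} {pOld : M.ScalField}
    {L L' : M.MatField} {u u' : M.VecField} {p p' : M.ScalField} {lam lam' : M.SkelField}
    (h : SolvesStep star k τ dt f pOld L u p lam) (h' : SolvesStep star k τ dt f pOld L' u' p' lam') :
    L = L' ∧ u = u' ∧ p = p' ∧ ∀ F, Set.EqOn (lam F) (lam' F) (hull F.1) := by
  obtain ⟨g, hg, hr⟩ := exists_rep h.lam_mem
  obtain ⟨g', hg', hr'⟩ := exists_rep h'.lam_mem
  obtain ⟨hx, hs⟩ := (solvesStep_iff h.lam_mem hg hr).1 h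
  obtain ⟨hx', hs'⟩ := (solvesStep_iff h'.lam_mem hg' hr').1 h'
  have key := eq_zero_of_stepForm hτ (one_div_pos.2 hdt) (Submodule.sub_mem _ hx hx')
    (star := star) fun y hy => by
      rw [map_sub, LinearMap.sub_apply, hs y hy, hs' y hy, sub_self]
  refine ⟨sub_eq_zero.1 key.1, sub_eq_zero.1 key.2.1, sub_eq_zero.1 key.2.2.1, fun F y hy => ?_⟩
  ext i
  have h1 : ev (g F i - g' F i) y = 0 := key.2.2.2 F y hy i
  rw [hr F y hy, hr' F y hy, ← sub_eq_zero, ← ev_sub, h1]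

/-! ### Existence of a step and of the initial projection. -/

/-- One step of the scheme is solvable. -/
theorem exists_solvesStep (star : M.StarChoice) (k : ℕ) {τ dt : ℝ} (hτ : 0 < τ) (hdt : 0 < dt)
    {f : Pt → Pt} (hf : ∀ T : M.cells, ∀ i, ∀ q : Poly, IntegrableOn (fun x => f x i * ev q x) (hull T))
    (pOld : M.ScalField) : ∃ L u p lam, SolvesStep star k τ dt f pOld L u p lam := by
  have hload : ∀ v : M.VecField, M.load f v =
      ∑ T : M.cells, ∑ i, ∫ x in hull T, f x i * ev (v T i) x := fun v =>
    Finset.sum_congr rfl fun T _ => integral_finsetSum _ fun i _ => hf T i (v T i)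
  let ℓ₀ : M.VecField →ₗ[ℝ] ℝ :=
    { toFun := M.load f
      map_add' := fun v w => by
        simp only [hload, ← Finset.sum_add_distrib]
        refine Finset.sum_congr rfl fun T _ => Finset.sum_congr rfl fun i _ => ?_
        rw [← integral_add (hf T i _) (hf T i _)]
        simp only [Pi.add_apply, ev_add, mul_add]
      map_smul' := fun c v => by
        simp only [hload, RingHom.id_apply, smul_eq_mul, Finset.mul_sum]
        refine Finset.sum_congr rfl fun T _ => Finset.sum_congr rfl fun i _ => ?_
        rw [← integral_const_mul]
        simp only [Pi.smul_apply, ev_smul, mul_left_comm] }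
  let B := (stepForm star τ (1 / dt)).domRestrict₁₂ (M.stateSpace k) (M.stateSpace k)
  let ℓ : M.stateSpace k →ₗ[ℝ] ℝ :=
    (ℓ₀.comp (LinearMap.fst ℝ _ _ ∘ₗ LinearMap.snd ℝ _ _) + (1 / dt) • (M.formQ pOld).comp
      (LinearMap.fst ℝ _ _ ∘ₗ LinearMap.snd ℝ _ _ ∘ₗ LinearMap.snd ℝ _ _)).comp
      (M.stateSpace k).subtype
  have hker : ∀ x : M.stateSpace k, (∀ y, B x y = 0) → x.1.1 = 0 ∧ x.1.2.1 = 0 ∧ x.1.2.2.1 = 0 ∧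
      ∀ F, ∀ y ∈ hull F.1, ∀ i, ev (x.1.2.2.2 F i) y = 0 := fun x hx =>
    eq_zero_of_stepForm hτ (one_div_pos.2 hdt) x.2 (star := star) fun y hy => hx ⟨y, hy⟩
  -- The kernel need not be trivial: a nonzero polynomial representative may vanish on its face. It
  -- is harmless, as such representatives are also invisible as test functions.
  obtain ⟨x, hx⟩ := exists_forall_eq B (fun x hx y => by
    obtain ⟨h1, h2, h3, h4⟩ := hker x hx
    change stepForm star τ (1 / dt) y.1 x.1 = 0
    have hz : ∀ a, M.formT a (M.skelL x.1.2.2.2) = 0 := fun a => by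
      rw [formT_comm, formT_congr (b := 0), map_zero, LinearMap.zero_apply]
      intro T F z hz i
      exact (h4 F z hz i).trans (ev_zero z).symm
    rw [stepForm_apply, h1, h2, h3, hz]
    simp) ℓ (fun x hx => by
    obtain ⟨h1, h2, h3, h4⟩ := hker x hx
    change ℓ₀ x.1.2.1 + (1 / dt) * M.formQ pOld x.1.2.2.1 = 0
    rw [h2, h3]
    simp)
  exact ⟨x.1.1, x.1.2.1, x.1.2.2.1, M.skelFun x.1.2.2.2,
    (solvesStep_iff (skelFun_mem x.2.2.2.2) x.2.2.2.2 (fun _ _ _ _ => rfl)).2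
      ⟨x.2, fun y hy => hx ⟨y, hy⟩⟩⟩

/-- The `L²` projection onto piecewise polynomials exists. -/
theorem exists_projection (k : ℕ) {p₀ : Pt → ℝ}
    (hp : ∀ T : M.cells, ∀ q : Poly, IntegrableOn (fun x => p₀ x * ev q x) (hull T)) :
    ∃ p ∈ M.Q k, ∀ q ∈ M.Q k, M.innerQ p q = M.loadQ p₀ q := by
  have hcell : ∀ T : M.cells, ∃ r ∈ P k, ∀ s ∈ P k,
      cellInt T (r * s) = ∫ x in hull T, p₀ x * ev s x := by
    intro T
    let B : P k →ₗ[ℝ] P k →ₗ[ℝ] ℝ :=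
      ((LinearMap.mul ℝ Poly).compr₂ (cellInt T)).domRestrict₁₂ (P k) (P k)
    let ℓ : P k →ₗ[ℝ] ℝ :=
      { toFun := fun s => ∫ x in hull T, p₀ x * ev s x
        map_add' := fun s t => by
          rw [← integral_add (hp T _) (hp T _)]
          simp only [Submodule.coe_add, ev_add, mul_add]
        map_smul' := fun c s => by
          rw [RingHom.id_apply, smul_eq_mul, ← integral_const_mul]
          simp only [Submodule.coe_smul, ev_smul, mul_left_comm] }
    have hker : ∀ x, (∀ y, B x y = 0) → x = 0 := fun x hx =>
      Subtype.ext (eq_zero_of_cellInt_sq (hx x))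
    obtain ⟨r, hr⟩ := exists_forall_eq B (fun x hx y => by rw [hker x hx, map_zero]) ℓ
      (fun x hx => by rw [hker x hx, map_zero])
    exact ⟨r, r.2, fun s hs => hr ⟨s, hs⟩⟩
  choose p hp hps using hcell
  refine ⟨p, hp, fun q hq => ?_⟩
  rw [innerQ_eq, formQ_apply, loadQ]
  refine Finset.sum_congr rfl fun T _ => ?_
  rw [hps T _ (hq T), cellInner]
  simp

theorem eq_of_innerQ_eq {k : ℕ} {p p' : M.ScalField} (hp : p ∈ M.Q k) (hp' : p' ∈ M.Q k)
    (h : ∀ q ∈ M.Q k, M.innerQ p q = M.innerQ p' q) : p = p' := by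
  have h1 := h (p - p') fun T => Submodule.sub_mem _ (hp T) (hp' T)
  rw [innerQ_eq, innerQ_eq, ← sub_eq_zero, ← LinearMap.sub_apply, ← map_sub] at h1
  exact sub_eq_zero.1 (eq_zero_of_formQ h1)

/-! ### Changing the stabilization parameter. -/

/-- Orthogonality to the polynomials of lower degree. -/
def OrthLower (k : ℕ) (w : M.VecField) : Prop :=
  ∀ T : M.cells, ∀ i, ∀ s : Poly, s.totalDegree < k → cellInt T (w T i * s) = 0

/-- First derivatives lower the degree below `k`, or vanish if `k = 0`. So such a `w` is invisible
to the gradient equation, and as a test function it does not see `∇·L`. -/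
theorem formV_divL_eq_zero {k : ℕ} {w : M.VecField} (hw : OrthLower k w) {G : M.MatField}
    (hG : G ∈ M.W k) : M.formV w (M.divL G) = 0 := by
  refine Finset.sum_eq_zero fun T _ => Finset.sum_eq_zero fun i _ => ?_
  change cellInt T (w T i * ∑ j, dd j (G T i j)) = 0
  rw [Finset.mul_sum, map_sum]
  refine Finset.sum_eq_zero fun j _ => ?_
  rcases Nat.eq_zero_or_pos k with rfl | hk
  · rw [dd_eq_zero (hG T i j), mul_zero, map_zero]
  · exact hw T i _ ((mem_P.1 (dd_mem_P (hG T i j) j)).trans_lt (by omega))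

theorem formV_gradL_eq_zero {k : ℕ} {w : M.VecField} (hw : OrthLower k w) {q : M.ScalField}
    (hq : q ∈ M.Q k) : M.formV w (M.gradL q) = 0 := by
  refine Finset.sum_eq_zero fun T _ => Finset.sum_eq_zero fun i _ => ?_
  change cellInt T (w T i * dd i (q T)) = 0
  rcases Nat.eq_zero_or_pos k with rfl | hk
  · rw [dd_eq_zero (hq T), mul_zero, map_zero]
  · exact hw T i _ ((mem_P.1 (dd_mem_P (hq T) i)).trans_lt (by omega))

/-- Changing the stabilization parameter while correcting only the velocity. -/
theorem SolvesStep.transfer {star : M.StarChoice} {k : ℕ} {τ₁ τ₂ dt : ℝ}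
    {f : Pt → Pt} {pOld : M.ScalField}
    {L : M.MatField} {u : M.VecField} {p : M.ScalField} {lam : M.SkelField}
    (h : SolvesStep star k τ₁ dt f pOld L u p lam) {w : M.VecField} (hwk : w ∈ M.V k)
    (hw : OrthLower k w)
    (hwt : ∀ T i, ∀ x ∈ hull (star.face T).1, τ₂ * (ev (u T i) x + ev (w T i) x - lam (star.face T) x i) =
      τ₁ * (ev (u T i) x - lam (star.face T) x i)) :
    SolvesStep star k τ₂ dt f pOld L (u + w) p lam := by
  obtain ⟨g, hg, hr⟩ := exists_rep h.lam_mem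
  obtain ⟨hx, hs⟩ := (solvesStep_iff h.lam_mem hg hr).1 h
  refine (solvesStep_iff h.lam_mem hg hr).2 ⟨⟨hx.1, fun T i => Submodule.add_mem _ (hx.2.1 T i) (hwk T i),
    hx.2.2.1, hx.2.2.2⟩, fun y hy => ?_⟩
  rw [← hs y hy]
  have hst : ∀ b, M.formT (stabL star τ₂ (u + w, g)) b = M.formT (stabL star τ₁ (u, g)) b := by
    intro b
    refine formT_congr fun T F x hx i => ?_
    simp only [stabL, LinearMap.coe_mk, AddHom.coe_mk]
    by_cases hF : F = star.face T
    · subst hF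
      have := hwt T i x hx
      rw [hr _ x hx] at this
      simp only [if_true, ev_smul, ev_sub, Pi.add_apply, ev_add]
      exact this
    · simp [hF]
  simp only [stepForm_apply, map_add, LinearMap.add_apply, hst, formV_divL_eq_zero hw hy.1,
    formV_gradL_eq_zero hw hy.2.2.1]
  ring

theorem exists_vec_lift {k : ℕ} (T : M.cells) {F : M.facets} (hF : F ∈ M.facetsOf T) {g : Fin 3 → Poly}
    (hg : ∀ i, g i ∈ P k) : ∃ w : Fin 3 → Poly, (∀ i, w i ∈ P k) ∧
      (∀ i, ∀ x ∈ hull F.1, ev (w i) x = ev (g i) x) ∧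
      ∀ i, ∀ s : Poly, s.totalDegree < k → cellInt T (w i * s) = 0 := by
  obtain ⟨b, hb, hFb⟩ := exists_vertex hF
  choose w hw hwF hwo using fun i => exists_orthogonal_lift (M.indep_cell T) (M.card_cell T) hb (hg i)
  exact ⟨w, hw, by rw [hFb]; exact hwF, hwo⟩

/-- For every other positive parameter the step has a solution with the same gradient, pressure and
skeleton function. -/
theorem SolvesStep.exists_other {star : M.StarChoice} {k : ℕ} {τ₁ τ₂ dt : ℝ} (hτ₂ : 0 < τ₂)
    {f : Pt → Pt} {pOld : M.ScalField}
    {L : M.MatField} {u : M.VecField} {p : M.ScalField} {lam : M.SkelField}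
    (h : SolvesStep star k τ₁ dt f pOld L u p lam) :
    ∃ u', SolvesStep star k τ₂ dt f pOld L u' p lam := by
  obtain ⟨g, hg, hr⟩ := exists_rep h.lam_mem
  -- The trace of `w` is the solution of `τ₂ (u + w - λ) = τ₁ (u - λ)` on the distinguished face.
  choose w hwk hwF hwo using fun T => exists_vec_lift T (star.mem T)
    (g := fun i => ((τ₁ - τ₂) / τ₂) • (u T i - g (star.face T) i)) (k := k)
    fun i => Submodule.smul_mem _ _ (Submodule.sub_mem _ (h.u_mem T i) (hg _ i).1)
  refine ⟨u + w, h.transfer hwk hwo fun T i x hx => ?_⟩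
  rw [hwF T i x hx, ev_smul, ev_sub, hr _ x hx]
  field_simp
  ring

/-- The momentum equation tested with functions orthogonal to the polynomials of lower degree. -/
theorem SolvesStep.stab_eq_load {star : M.StarChoice} {k : ℕ} {τ dt : ℝ}
    {f : Pt → Pt} {pOld : M.ScalField}
    {L : M.MatField} {u : M.VecField} {p : M.ScalField} {lam : M.SkelField} {g : M.PolySkel}
    (h : SolvesStep star k τ dt f pOld L u p lam)
    (hg : g ∈ M.skelSpace k) (hr : ∀ F, ∀ x ∈ hull F.1, ∀ i, lam F x i = ev (g F i) x)
    (T : M.cells) {v : Fin 3 → Poly} (hv : ∀ i, v i ∈ P k)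
    (hvo : ∀ i, ∀ s : Poly, s.totalDegree < k → cellInt T (v i * s) = 0) :
    τ * ∑ i, faceInt (star.face T) ((u T i - g (star.face T) i) * v i) =
      cellInner T (fun i x => f x i) (fun i => ev (v i)) := by
  classical
  obtain ⟨hx, hs⟩ := (solvesStep_iff h.lam_mem hg hr).1 h
  have hvk : Pi.single T v ∈ M.V k := fun T' i => by
    by_cases hT : T' = T
    · subst hT; simpa using hv i
    · simp [hT]
  have hvo' : OrthLower k (Pi.single T v : M.VecField) := fun T' i s hs => by
    by_cases hT : T' = T
    · subst hT; simpa using hvo i s hs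
    · simp [hT]
  have h1 := hs (0, Pi.single T v, 0, 0) ⟨fun _ _ _ => Submodule.zero_mem _, hvk,
    fun _ => Submodule.zero_mem _, Submodule.zero_mem _⟩
  simp only [stepForm_apply, map_zero, mul_zero, add_zero, sub_zero, zero_add] at h1
  rw [formV_comm, map_add, map_neg, formV_divL_eq_zero hvo' hx.1, formV_gradL_eq_zero hvo' hx.2.2.1,
    neg_zero, zero_add, zero_add, formT_stabL, Finset.sum_eq_single T, load,
    Finset.sum_eq_single T] at h1
  · simpa [trVL] using h1
  · intro T' _ hT
    simp [cellInner, hT, ev_zero]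
  · simp
  · intro T' _ hT
    simp [trVL, hT]
  · simp

theorem orth_of_cellInner {k : ℕ} {T : M.cells} {v : Fin 3 → Poly}
    (h : ∀ w : Fin 3 → Poly, (∀ i, (w i).totalDegree < k) →
      cellInner T (fun i => ev (v i)) (fun i => ev (w i)) = 0) (i : Fin 3) (s : Poly)
    (hs : s.totalDegree < k) : cellInt T (v i * s) = 0 := by
  classical
  have h1 := h (Pi.single i s) fun i' => by
    by_cases hi : i' = i
    · subst hi; simpa using hs
    · simpa [hi] using (Nat.zero_le _).trans_lt hs
  rw [cellInner_ev, Finset.sum_eq_single i] at h1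
  · simpa using h1
  · intro i' _ hi; simp [hi]
  · simp

/-- The velocity matches the skeleton function on the distinguished faces exactly if the right-hand
side has no component of top degree. -/
theorem SolvesStep.noTopDegree_iff {star : M.StarChoice} {k : ℕ} {τ dt : ℝ} (hτ : 0 < τ)
    {f : Pt → Pt} {pOld : M.ScalField}
    {L : M.MatField} {u : M.VecField} {p : M.ScalField} {lam : M.SkelField}
    (h : SolvesStep star k τ dt f pOld L u p lam) :
    M.NoTopDegree k f ↔ ∀ T i, ∀ x ∈ hull (star.face T).1, ev (u T i) x = lam (star.face T) x i := by
  obtain ⟨g, hg, hr⟩ := exists_rep h.lam_mem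
  constructor
  · intro hf T
    -- Testing with a lift of `u - λ` turns the reduced momentum equation into `τ ∫ |u - λ|² = (f,
    -- v) = 0` on the distinguished face.
    obtain ⟨v, hv, hvF, hvo⟩ := exists_vec_lift T (star.mem T)
      (g := fun i => u T i - g (star.face T) i) (k := k)
      fun i => Submodule.sub_mem _ (h.u_mem T i) (hg _ i).1
    have h1 := h.stab_eq_load hg hr T hv hvo
    rw [hf T v hv fun w hw => by
      rw [cellInner_ev]; exact Finset.sum_eq_zero fun i _ => hvo i _ (hw i)] at h1
    have h2 : ∀ i, faceInt (star.face T) ((u T i - g (star.face T) i) * v i) =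
        faceInt (star.face T) ((u T i - g (star.face T) i) * (u T i - g (star.face T) i)) := fun i =>
      faceInt_congr _ fun x hx => by rw [ev_mul, ev_mul, hvF i x hx]
    simp only [h2] at h1
    intro i x hx
    have h3 := (Finset.sum_eq_zero_iff_of_nonneg fun i _ => faceInt_sq_nonneg _ _).1
      ((mul_eq_zero.1 h1).resolve_left hτ.ne') i (Finset.mem_univ _)
    have h4 := eq_zero_of_faceInt_sq _ h3 x hx
    rw [hr _ x hx]
    rwa [ev_sub, sub_eq_zero] at h4
  · intro hu T v hv hvo
    rw [← h.stab_eq_load hg hr T hv (orth_of_cellInner hvo), Finset.sum_eq_zero, mul_zero]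
    intro i _
    rw [faceInt_congr _ (q := 0) fun x hx => by
      rw [ev_mul, ev_sub, hu T i x hx, hr _ x hx, sub_self, zero_mul, ev_zero], map_zero]

/-- Dependence of one step on the stabilization parameter. -/
theorem SolvesStep.compare {star : M.StarChoice} {k : ℕ} {τ₁ τ₂ dt : ℝ} (hτ₁ : 0 < τ₁) (hτ₂ : 0 < τ₂)
    (hdt : 0 < dt) {f : Pt → Pt} {pOld : M.ScalField}
    {L₁ L₂ : M.MatField} {u₁ u₂ : M.VecField} {p₁ p₂ : M.ScalField} {lam₁ lam₂ : M.SkelField}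
    (h₁ : SolvesStep star k τ₁ dt f pOld L₁ u₁ p₁ lam₁)
    (h₂ : SolvesStep star k τ₂ dt f pOld L₂ u₂ p₂ lam₂) :
    (∀ F, Set.EqOn (lam₁ F) (lam₂ F) (hull F.1)) ∧ p₁ = p₂ ∧ L₁ = L₂ ∧
      (u₁ = u₂ ↔ τ₁ = τ₂ ∨ M.NoTopDegree k f) := by
  -- The modified solution for `τ₂` keeps `L`, `p`, `λ`, so uniqueness for `τ₂` carries these over
  -- to the given one.
  obtain ⟨u', h'⟩ := h₁.exists_other hτ₂
  obtain ⟨hL, -, hp, hlam⟩ := h'.unique hτ₂ hdt h₂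
  refine ⟨hlam, hp, hL, ?_, ?_⟩
  · rintro rfl
    refine or_iff_not_imp_left.2 fun hne => ?_
    obtain ⟨g₁, hg₁, hr₁⟩ := exists_rep h₁.lam_mem
    obtain ⟨g₂, hg₂, hr₂⟩ := exists_rep h₂.lam_mem
    intro T v hv hvo
    have e₁ := h₁.stab_eq_load hg₁ hr₁ T hv (orth_of_cellInner hvo)
    have e₂ := h₂.stab_eq_load hg₂ hr₂ T hv (orth_of_cellInner hvo)
    have e₃ : ∀ i, faceInt (star.face T) ((u₁ T i - g₂ (star.face T) i) * v i) =
        faceInt (star.face T) ((u₁ T i - g₁ (star.face T) i) * v i) := fun i =>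
      faceInt_congr _ fun x hx => by
        rw [ev_mul, ev_mul, ev_sub, ev_sub, ← hr₁ _ x hx, ← hr₂ _ x hx, hlam _ hx]
    simp only [e₃] at e₂
    -- Both `τ₁` and `τ₂` times the same face integral equal the load, so that integral vanishes.
    have e₄ := e₁.trans e₂.symm
    rw [← sub_eq_zero, ← sub_mul] at e₄
    rw [← e₁, (mul_eq_zero.1 e₄).resolve_left (sub_ne_zero.2 hne), mul_zero]
  · rintro (rfl | hf)
    · exact (h₁.unique hτ₁ hdt h₂).2.1
    · have hm := (h₁.noTopDegree_iff hτ₁).1 hf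
      -- With `u = λ` on the distinguished faces the stabilization is zero for every parameter, so
      -- no correction is needed.
      have h₃ := h₁.transfer (τ₂ := τ₂) (w := 0) (fun _ _ => Submodule.zero_mem _)
        (fun _ _ _ _ => by simp) fun T i x hx => by
          rw [Pi.zero_apply, Pi.zero_apply, ev_zero, add_zero, hm T i x hx]; ring
      rw [add_zero] at h₃
      exact (h₃.unique hτ₂ hdt h₂).2.1

/-! ### Integrability and the mesh -/

/-- A cell lies in `closure Ω`, so its interior lies in `interior (closure Ω) = Ω`; the frontier of
a convex set is null. This gives integrability on closed cells from `L²(Ω)`. -/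
theorem restrict_hull_le (hΩ : interior (closure Ω) = Ω) (T : M.cells) :
    volume.restrict (hull T.1) ≤ volume.restrict Ω := by
  have hsub : interior (hull T.1) ⊆ Ω :=
    (interior_mono ((M.convexHull_subset_space (M.cell_mem_faces T)).trans M.space_eq.subset)).trans
      hΩ.subset
  have hae : (hull T.1 : Set Pt) =ᵐ[volume] interior (hull T.1) :=
    ((interior_ae_eq_of_null_frontier ((convex_convexHull ℝ _).addHaar_frontier _))).symm
  rw [Measure.restrict_congr_set hae]
  exact Measure.restrict_mono hsub le_rfl

theorem integrableOn_mul_ev (hΩ : interior (closure Ω) = Ω) (T : M.cells) {φ : Pt → ℝ}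
    (hφ : MemLp φ 2 (volume.restrict Ω)) (q : Poly) :
    IntegrableOn (fun x => φ x * ev q x) (hull T.1) := by
  have : IsFiniteMeasure (volume.restrict (hull T.1)) :=
    ⟨by rw [Measure.restrict_apply_univ]; exact (isCompact_hull T.1).measure_lt_top⟩
  have h1 : IntegrableOn φ (hull T.1) :=
    (hφ.mono_measure (restrict_hull_le hΩ T)).integrable (by norm_num)
  exact h1.mul_continuousOn (continuous_ev q).continuousOn (isCompact_hull T.1)

theorem isCompact_closure_domain (M : Mesh Ω) : IsCompact (closure Ω) := by
  rw [← M.space_eq]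
  exact M.finite_faces.isCompact_biUnion fun s _ => isCompact_hull s

theorem exists_mem_cells (M : Mesh Ω) (hΩ : Ω.Nonempty) : Nonempty M.cells := by
  obtain ⟨x, hx⟩ := hΩ.closure
  rw [← M.space_eq, Geometry.SimplicialComplex.mem_space_iff] at hx
  obtain ⟨s, hs, -⟩ := hx
  obtain ⟨T, hT, -, hc⟩ := M.pure s hs
  exact ⟨⟨T, Finset.mem_filter.2 ⟨by simpa using hT, hc⟩⟩⟩

/-- On one cell let `w` be an orthogonal lift of the trace `1` on a face; it is nonzero. The field
with all components `w` is admissible as a test function on that cell and not orthogonal to itself.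
-/
theorem exists_not_noTopDegree (M : Mesh Ω) (hΩ : Ω.Nonempty) (k : ℕ) :
    ∃ f : Pt → Pt, MemLp f 2 (volume.restrict Ω) ∧ ¬ M.NoTopDegree k f := by
  obtain ⟨T⟩ := M.exists_mem_cells hΩ
  obtain ⟨b, hb⟩ : T.1.Nonempty := Finset.card_pos.1 (by rw [M.card_cell]; norm_num)
  obtain ⟨w, hw, hwF, hwo⟩ := exists_orthogonal_lift (M.indep_cell T) (M.card_cell T) hb
    (g := 1) (k := k) (mem_P.2 (by simp))
  have hw0 : w ≠ 0 := by
    rintro rfl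
    obtain ⟨y, hy⟩ : (T.1.erase b).Nonempty :=
      Finset.card_pos.1 (by rw [Finset.card_erase_of_mem hb, M.card_cell]; norm_num)
    have := hwF y (subset_convexHull ℝ _ hy)
    rw [ev_zero, ev_one] at this
    exact zero_ne_one this
  refine ⟨fun x => WithLp.toLp 2 fun _ => ev w x, ?_, fun h => hw0 ?_⟩
  · have hc : Continuous fun x : Pt => (WithLp.toLp 2 fun _ => ev w x : Pt) := by
      have := continuous_ev w
      fun_prop
    obtain ⟨C, hC⟩ := M.isCompact_closure_domain.exists_bound_of_continuousOn hc.continuousOn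
    refine MemLp.mono_measure (Measure.restrict_mono subset_closure le_rfl) ?_
    have hfin : IsFiniteMeasure (volume.restrict (closure Ω)) :=
      ⟨by rw [Measure.restrict_apply_univ]; exact M.isCompact_closure_domain.measure_lt_top⟩
    refine MemLp.of_bound hc.aestronglyMeasurable C ?_
    exact (ae_restrict_iff' isClosed_closure.measurableSet).2 (.of_forall hC)
  · have h1 := h T (fun _ => w) (fun _ => hw) fun s hs => by
      rw [cellInner_ev]
      exact Finset.sum_eq_zero fun i _ => hwo _ (hs i)
    have h2 : cellInner T.1 (fun i : Fin 3 => ev ((fun _ => w) i)) (fun i => ev ((fun _ => w) i)) = 0 := h1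
    rw [cellInner_ev] at h2
    refine eq_zero_of_cellInt_sq (T := T) ?_
    simpa using h2

/-! ### The iteration over time steps. -/

/-- The iteration exists. -/
theorem exists_isIteration (star : M.StarChoice) (k : ℕ) {τ dt : ℝ} (hτ : 0 < τ) (hdt : 0 < dt)
    {f : Pt → Pt} {p₀ : Pt → ℝ}
    (hf : ∀ T : M.cells, ∀ i, ∀ q : Poly, IntegrableOn (fun x => f x i * ev q x) (hull T))
    (hp : ∀ T : M.cells, ∀ q : Poly, IntegrableOn (fun x => p₀ x * ev q x) (hull T)) :
    ∃ L u p lam, IsIteration star k τ dt f p₀ L u p lam := by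
  obtain ⟨pi, hpi, hpi'⟩ := exists_projection k hp
  choose L u p lam h using exists_solvesStep star k hτ hdt hf
  let pn : ℕ → M.ScalField := fun n => p^[n] pi
  -- Step `n` is driven by the pressure of step `n - 1`; the value at `n = 0` is meaningless.
  refine ⟨fun n => L (pn (n - 1)), fun n => u (pn (n - 1)), pn, fun n => lam (pn (n - 1)), hpi, hpi',
    fun n => ?_⟩
  have : pn (n + 1) = p (pn n) := Function.iterate_succ_apply' _ _ _
  rw [this]
  exact h (pn n)

theorem IsIteration.compare {star : M.StarChoice} {k : ℕ} {τ₁ τ₂ dt : ℝ} (hτ₁ : 0 < τ₁) (hτ₂ : 0 < τ₂)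
    (hdt : 0 < dt) {f : Pt → Pt} {p₀ : Pt → ℝ}
    {L₁ L₂ : ℕ → M.MatField} {u₁ u₂ : ℕ → M.VecField} {p₁ p₂ : ℕ → M.ScalField}
    {lam₁ lam₂ : ℕ → M.SkelField}
    (h₁ : IsIteration star k τ₁ dt f p₀ L₁ u₁ p₁ lam₁)
    (h₂ : IsIteration star k τ₂ dt f p₀ L₂ u₂ p₂ lam₂) (n : ℕ) (hn : 1 ≤ n) :
    (∀ F, Set.EqOn (lam₁ n F) (lam₂ n F) (hull F.1)) ∧ p₁ n = p₂ n ∧ L₁ n = L₂ n ∧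
      (u₁ n = u₂ n ↔ τ₁ = τ₂ ∨ M.NoTopDegree k f) := by
  -- Only the pressure passes from one step to the next, so its independence of the parameter
  -- reduces everything to single steps with equal data.
  have hp : ∀ n, p₁ n = p₂ n := by
    intro n
    induction n with
    | zero =>
      exact eq_of_innerQ_eq h₁.init_mem h₂.init_mem fun q hq =>
        (h₁.init_eq q hq).trans (h₂.init_eq q hq).symm
    | succ n ih => exact ((h₁.step n).compare hτ₁ hτ₂ hdt (ih ▸ h₂.step n)).2.1
  obtain ⟨m, rfl⟩ : ∃ m, n = m + 1 := ⟨n - 1, by omega⟩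
  exact (h₁.step m).compare hτ₁ hτ₂ hdt (hp m ▸ h₂.step m)

end Mesh
end StokesHDG

/-- Of the Lipschitz property only `interior (closure Ω) = Ω` is needed, and boundedness is implied
by the finite mesh. Uniqueness of the iterates is the case `τ₁ = τ₂`, in which the last equivalence
also yields equal velocities. -/
theorem mainTheorem4 {Ω : Set StokesHDG.Pt} (hΩ_ne : Ω.Nonempty)
    (hΩ_reg : interior (closure Ω) = Ω) (M : StokesHDG.Mesh Ω) (star : M.StarChoice)
    (k : ℕ) (dt : ℝ) (hdt : 0 < dt) :
    (∀ (f : StokesHDG.Pt → StokesHDG.Pt) (p₀ : StokesHDG.Pt → ℝ),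
      MemLp f 2 (volume.restrict Ω) → MemLp p₀ 2 (volume.restrict Ω) →
      -- the iterates exist for every positive value of the stabilization parameter
      (∀ τ : ℝ, 0 < τ → ∃ L u p lam,
        StokesHDG.Mesh.IsIteration star k τ dt f p₀ L u p lam) ∧
      ∀ τ₁ τ₂ : ℝ, 0 < τ₁ → 0 < τ₂ → ∀ L₁ u₁ p₁ lam₁ L₂ u₂ p₂ lam₂,
        StokesHDG.Mesh.IsIteration star k τ₁ dt f p₀ L₁ u₁ p₁ lam₁ →
        StokesHDG.Mesh.IsIteration star k τ₂ dt f p₀ L₂ u₂ p₂ lam₂ →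
        ∀ n : ℕ, 1 ≤ n →
          -- the skeleton function, the pressure and the gradient do not depend on the parameter
          (∀ F, Set.EqOn (lam₁ n F) (lam₂ n F) (StokesHDG.hull F)) ∧
          p₁ n = p₂ n ∧ L₁ n = L₂ n ∧
          -- the velocity is unique, and depends on the parameter exactly if `f` has a component
          -- of top degree on some cell
          (u₁ n = u₂ n ↔ τ₁ = τ₂ ∨ M.NoTopDegree k f)) ∧
    -- such right-hand sides exist
    (∃ f : StokesHDG.Pt → StokesHDG.Pt,
      MemLp f 2 (volume.restrict Ω) ∧ ¬ M.NoTopDegree k f) := by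
  refine ⟨fun f p₀ hf hp₀ => ⟨fun τ hτ => ?_, fun τ₁ τ₂ h₁ h₂ L₁ u₁ p₁ lam₁ L₂ u₂ p₂ lam₂ i₁ i₂ =>
    i₁.compare h₁ h₂ hdt i₂⟩, M.exists_not_noTopDegree hΩ_ne k⟩
  refine StokesHDG.Mesh.exists_isIteration star k hτ hdt (fun T i q => ?_) (fun T q => ?_)
  · refine StokesHDG.Mesh.integrableOn_mul_ev hΩ_reg T ?_ q
    exact (PiLp.proj 2 (fun _ : Fin 3 => ℝ) i : StokesHDG.Pt →L[ℝ] ℝ).comp_memLp' hf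
  · exact StokesHDG.Mesh.integrableOn_mul_ev hΩ_reg T hp₀ q
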